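/- Let $M\ge 1$ and let $S^{(t)}\ge 1$ ($t\in\mathbb Z$) be integers. Consider the box--ball system with $M$ kinds of balls and carrier capacity $S^{(t)}$: nonnegative integers $U^{(k,t)}_n, V^{(k,t)}_n$ ($k\in\mathbb Z/(M+1)\mathbb Z$, $t,n\in\mathbb Z$), where for $k=1,\dots,M$ the number of balls of index $k$ in the $n$-th box at time $t$ is $U^{(k,t)}_n$ and the number of balls of index $k$ in the carrier at the $n$-th box from time $t$ to $t+1$ is $V^{(k,t)}_n$, and $k=0$ counts empty spaces, such that $$U^{(k,t+1)}_n=U^{(k,t)}_n-X^{(k,t)}_n+X^{(k+1,t)}_n,\qquad V^{(k,t)}_{n+1}=V^{(k,t)}_n+X^{(k,t)}_n-X^{(k+1,t)}_n,$$ $$X^{(k,t)}_n=\min_{i=0,\dots,M}\Bigl(\sum_{j=0}^{M-i-1}U^{(k+j,t)}_n+\sum_{j=M-i+1}^{M}V^{(k+j,t)}_n\Bigr),$$ with, for each $t$, $U^{(0,t)}_n=1$, $V^{(0,t)}_n=S^{(t)}$ and $U^{(k,t)}_n=V^{(k,t)}_n=0$ ($k=1,\dots,M$) for all sufficiently large $|n|$,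 and with $\sum_{k=0}^{M}U^{(k,0)}_n=1$ for all $n$. A block of balls at time $t$ is a maximal run of consecutive nonempty boxes along which the ball indices are non-decreasing from left to right (so adjacent blocks may be separated by no empty box). Blocks are numbered $0,1,2,\dots$ from left to right. Theorem. The number $N$ of blocks of balls is finite and does not depend on $t$. For all $t\in\mathbb Z$, let $Q^{(k,t)}_n$ be the number of balls of index $k$ in the $n$-th block at time $t$ ($1\le k\le M$, $0\le n\le N-1$), and let $E^{(1,t)}_n$ be the number of empty boxes between the $n$-th and the $(n+1)$-st blocks at time $t$ ($0\le n\le N-2$). These variables satisfy the nonautonomous ultradiscrete hungry Toda lattice with the finite lattice condition; that is, they are the members with these indices of families $Q^{(k,t)}_n, D^{(k,t)}_n\in\mathbb Z$ and $E^{(k,t)}_n,\tilde E^{(k,t)}_n,F^{(k,t)}_n\in\mathbb Z\cup\{+\infty\}$ ($k,t\in\mathbb Z$) satisfying, for all $k,t\in\mathbb Z$, $$Q^{(k,t+1)}_n=\min(D^{(k,t)}_n,\tilde E^{(k,t)}_n),\qquad E^{(k,t+1)}_n=\min(F^{(k,t)}_n,\tilde E^{(k+M,t)}_n)\qquad(0\le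 n\le N-1),$$ $$D^{(k,t)}_{n+1}=D^{(k,t)}_n-Q^{(k,t+1)}_n+Q^{(k,t)}_{n+1},\qquad F^{(k,t)}_{n+1}=F^{(k,t)}_n-E^{(k,t+1)}_n+E^{(k,t)}_{n+1},$$ $$\tilde E^{(k+1,t)}_n=\tilde E^{(k,t)}_n-Q^{(k,t+1)}_n+Q^{(k,t)}_{n+1},\qquad \tilde E^{(k,t)}_{n+1}=\tilde E^{(k+M,t)}_n-E^{(k,t+1)}_n+E^{(k,t)}_{n+1}\qquad(0\le n\le N-2),$$ the boundary condition $$D^{(k,t)}_0=Q^{(k,t)}_0,\quad F^{(k,t)}_0=E^{(k,t)}_0+\max\Bigl(0,S^{(t)}-\sum_{j=0}^{M-1}Q^{(k+j,t)}_0\Bigr),\quad \tilde E^{(k,t)}_0=E^{(k,t)}_0+\max\Bigl(0,\sum_{j=0}^{M-1}Q^{(k+j,t)}_0-S^{(t)}\Bigr),$$ and the finite lattice condition $E^{(k,t)}_{N-1}=\tilde E^{(k,t)}_{N-1}=+\infty$ (if $N\ge 1$), where $E^{(k,t)}_n$ and $\tilde E^{(k,t)}_n$ are finite for $0\le n\le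 N-2$. -/

import Mathlib

/-- The quantity `X^{(k)} = min_{i=0,…,M} (∑_{j=0}^{M-i-1} U^{(k+j)} + ∑_{j=M-i+1}^{M} V^{(k+j)})`
of the `(M+1)`-reduced ultradiscrete KP lattice at one box, where `u` is the content of the box
and `v` the content of the carrier. The periodicity of the indices modulo `M + 1` is built into
the index type `ZMod (M + 1)`. -/
def bbsExchange (M : ℕ) (u v : ZMod (M + 1) → ℕ) (k : ZMod (M + 1)) : ℕ :=
  (Finset.range (M + 1)).inf' Finset.nonempty_range_add_one fun i =>
    (∑ j ∈ Finset.range (M - i), u (k + (j : ZMod (M + 1)))) +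
      ∑ j ∈ Finset.Icc (M - i + 1) M, v (k + (j : ZMod (M + 1)))

/-- The box–ball system with `M` kinds of balls and carrier capacity `S t` at time `t`.
`U k t n` is the number of balls of index `k` in the `n`-th box at time `t`, and `V k t n` the
number of balls of index `k` in the carrier at the `n`-th box from time `t` to `t + 1`; the index
`k = 0` counts empty spaces. The evolution equations are written additively. -/
structure IsBoxBallSystem (M : ℕ) (S : ℤ → ℕ) (U V : ZMod (M + 1) → ℤ → ℤ → ℕ) : Prop where
  box_evolution : ∀ k t n,
    U k (t + 1) n + bbsExchange M (fun i => U i t n) (fun i => V i t n) k =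
      U k t n + bbsExchange M (fun i => U i t n) (fun i => V i t n) (k + 1)
  carrier_evolution : ∀ k t n,
    V k t (n + 1) + bbsExchange M (fun i => U i t n) (fun i => V i t n) (k + 1) =
      V k t n + bbsExchange M (fun i => U i t n) (fun i => V i t n) k
  boundary : ∀ t, ∃ n₀ : ℤ, ∀ n, n₀ ≤ |n| →
    U 0 t n = 1 ∧ V 0 t n = S t ∧ ∀ k, k ≠ 0 → U k t n = 0 ∧ V k t n = 0
  initial : ∀ n, ∑ j ∈ Finset.range (M + 1), U (j : ZMod (M + 1)) 0 n = 1

/-- The index of the ball in the `n`-th box at time `t` (`0` for an empty box), when every box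
holds exactly one ball or one empty space. -/
def boxIndex (M : ℕ) (U : ZMod (M + 1) → ℤ → ℤ → ℕ) (t n : ℤ) : ℕ :=
  ∑ k ∈ Finset.Icc 1 M, k * U (k : ZMod (M + 1)) t n

/-- The boxes `a, a + 1, …, b` form a block of balls of the state `c : ℤ → ℕ` (`c n` is the index
of the ball in the `n`-th box, `0` for an empty box): a maximal run of consecutive nonempty boxes
along which the indices are in ascending (non-decreasing) order from left to right. -/
structure IsBallBlock (c : ℤ → ℕ) (a b : ℤ) : Prop where
  le : a ≤ b
  occupied : ∀ n, a ≤ n → n ≤ b → c n ≠ 0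
  ascending : ∀ n, a ≤ n → n < b → c n ≤ c (n + 1)
  left_maximal : c (a - 1) = 0 ∨ c a < c (a - 1)
  right_maximal : c (b + 1) = 0 ∨ c (b + 1) < c b

/-- The state `c` has exactly `N` blocks of balls; numbered from left to right by
`n = 0, …, N - 1`, the `n`-th one occupies the boxes `a n, …, b n`. -/
structure IsBlockEnumeration (c : ℤ → ℕ) (N : ℕ) (a b : ℕ → ℤ) : Prop where
  isBlock : ∀ n, n < N → IsBallBlock c (a n) (b n)
  ordered : ∀ n, n + 1 < N → b n < a (n + 1)
  complete : ∀ x y, IsBallBlock c x y → ∃ n, n < N ∧ a n = x ∧ b n = y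

/-- The nonautonomous ultradiscrete hungry Toda lattice on the finite lattice `n = 0, …, N - 1`,
with its boundary condition at `n = 0` and the finite lattice condition
`E^{(k,t)}_{N-1} = Ẽ^{(k,t)}_{N-1} = +∞`; all other `E^{(k,t)}_n`, `Ẽ^{(k,t)}_n` are finite.
Arguments are ordered as `Q k t n`; `Et` is `Ẽ`. -/
structure IsNonautonomousUltradiscreteHungryToda (M N : ℕ) (S : ℤ → ℕ)
    (Q D : ℤ → ℤ → ℕ → ℤ) (E Et F : ℤ → ℤ → ℕ → WithTop ℤ) : Prop where
  q_eq : ∀ k t n, n < N →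
    (Q k (t + 1) n : WithTop ℤ) = min (D k t n : WithTop ℤ) (Et k t n)
  e_eq : ∀ k t n, n < N → E k (t + 1) n = min (F k t n) (Et (k + M) t n)
  d_eq : ∀ k t n, n + 1 < N → D k t (n + 1) = D k t n - Q k (t + 1) n + Q k t (n + 1)
  f_eq : ∀ k t n, n + 1 < N → F k t (n + 1) = F k t n - E k (t + 1) n + E k t (n + 1)
  et_eq_k : ∀ k t n, n + 1 < N →
    Et (k + 1) t n = Et k t n - (Q k (t + 1) n : WithTop ℤ) + (Q k t (n + 1) : WithTop ℤ)
  et_eq_n : ∀ k t n, n + 1 < N →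
    Et k t (n + 1) = Et (k + M) t n - E k (t + 1) n + E k t (n + 1)
  d_zero : ∀ k t, D k t 0 = Q k t 0
  f_zero : ∀ k t, F k t 0 =
    E k t 0 + ((max 0 ((S t : ℤ) - ∑ j ∈ Finset.range M, Q (k + j) t 0) : ℤ) : WithTop ℤ)
  et_zero : ∀ k t, Et k t 0 =
    E k t 0 + ((max 0 ((∑ j ∈ Finset.range M, Q (k + j) t 0) - (S t : ℤ)) : ℤ) : WithTop ℤ)
  finite_lattice : ∀ k t n, n + 1 = N → E k t n = ⊤ ∧ Et k t n = ⊤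
  interior_finite : ∀ k t n, n + 1 < N → E k t n ≠ ⊤ ∧ Et k t n ≠ ⊤

/-! Give an empty box the letter `M + 1`, larger than every ball. A block together with the empty
boxes after it is then one non-decreasing run of a word, and the blocks start at the descents. In
these letters the exchange rule says that a carrier loading a letter unloads the smallest strictly
larger letter it holds (a bump) or, failing that, its smallest letter (a pop). Each run starts with
a bump, and after its first pop only pops follow; the descents of the new word are exactly the
places where bumping ends, one for each run. So the number of blocks is conserved
(`IsCarrierPass.isRunPartition`). Counting letters between consecutive cuts gives min-plus formulas
for the new contents with `1 ≤ k ≤ M` and the new gaps (`letterCount_eq_min`, `excess_eq`).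

The lattice, however, has equations for all integers `k`. At a fixed time, moving the balls of index
`k` and renaming them `k + M` is an invertible map on windows `(Q k, …, Q (k + M - 1), E k)`, so the
orbit of the window at `k = 1` defines `Q` and `E` for every `k`. The crux is that the evolution
with finite capacity, applied to all `k` at once, commutes with this map
(`IsCapacityEvolution.isHungryToda`). The evolved family is therefore again the orbit of its window;
that window consists of the block data at time `t + 1`, so the evolved family is the family of time
`t + 1`.

Write `W` for the load of the carrier minus `S`. At every interior site `F = E + max 0 (-W)` and `Ẽ
= E + max 0 W`, as the boundary condition prescribes at `n = 0`. Commutation is proved by induction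
on the site from `D (k + M) n = min (d' k n) (F k n)`, where `d'` is the carrier of the autonomous
lattice on the evolved state. -/

/-! ### The autonomous lattice as an invertible map -/

/-- The number of balls carried over the gap `n` when the balls of one index move to the nearest
empty boxes on their right; `q` counts these balls in the blocks and `e` the empty boxes in the
gaps `n` with `n + 1 < N`. -/
def todaCarry (N : ℕ) (q e : ℕ → ℤ) : ℕ → ℤ
  | 0 => q 0
  | n + 1 => todaCarry N q e n -
      (if n + 1 < N then min (todaCarry N q e n) (e n) else todaCarry N q e n) + q (n + 1)

/-- The number of balls dropped in the gap `n`. -/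
def todaDrop (N : ℕ) (q e : ℕ → ℤ) (n : ℕ) : ℤ :=
  if n + 1 < N then min (todaCarry N q e n) (e n) else todaCarry N q e n

/-- The number of empty boxes in the gap `n` after the balls of one index have moved. -/
def todaGap (N : ℕ) (q e : ℕ → ℤ) (n : ℕ) : ℤ :=
  if n + 1 < N then e n - todaDrop N q e n + q (n + 1) else e n

/-- The carrier of the inverse move, which runs from right to left. -/
def todaCarryBackAux (N : ℕ) (q e : ℕ → ℤ) : ℕ → ℤ
  | 0 => q (N - 1)
  | m + 1 => todaCarryBackAux N q e m - min (todaCarryBackAux N q e m) (e (N - 2 - m)) +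
      q (N - 2 - m)

/-- The carrier of the inverse move at the gap `n`. -/
def todaCarryBack (N : ℕ) (q e : ℕ → ℤ) (n : ℕ) : ℤ :=
  if n < N then todaCarryBackAux N q e (N - 1 - n) else q n

/-- The number of balls in the blocks after the inverse move. -/
def todaDropBack (N : ℕ) (q e : ℕ → ℤ) : ℕ → ℤ
  | 0 => todaCarryBack N q e 0
  | n + 1 => if n + 1 < N then min (todaCarryBack N q e (n + 1)) (e n)
      else todaCarryBack N q e (n + 1)

/-- The number of empty boxes in the gaps after the inverse move. -/
def todaGapBack (N : ℕ) (q e : ℕ → ℤ) (n : ℕ) : ℤ :=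
  if n + 1 < N then e n + q n - todaDropBack N q e (n + 1) else e n

theorem todaCarry_succ (N : ℕ) (q e : ℕ → ℤ) (n : ℕ) :
    todaCarry N q e (n + 1) = todaCarry N q e n - todaDrop N q e n + q (n + 1) := rfl

theorem todaCarryBack_of_lt {N : ℕ} (q e : ℕ → ℤ) {n : ℕ} (h : n + 1 < N) :
    todaCarryBack N q e n =
      todaCarryBack N q e (n + 1) - min (todaCarryBack N q e (n + 1)) (e n) + q n := by
  have h1 : N - 1 - n = (N - 1 - (n + 1)) + 1 := by omega
  have h2 : N - 2 - (N - 1 - (n + 1)) = n := by omega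
  simp only [todaCarryBack, if_pos h, if_pos (show n < N by omega)]
  rw [h1, todaCarryBackAux, h2]

theorem todaCarryBack_of_le {N : ℕ} (q e : ℕ → ℤ) {n : ℕ} (h : N ≤ n + 1) :
    todaCarryBack N q e n = q n := by
  unfold todaCarryBack
  split_ifs with h1
  · have h2 : N - 1 - n = 0 := by omega
    have h3 : N - 1 = n := by omega
    rw [h2, todaCarryBackAux, h3]
  · rfl

/-- The move shifts both arguments of `min (carry n) (e n)` by `q (n + 1) - drop n`, so on the moved
state this minimum is `q (n + 1)`, and the backward recursion undoes the forward one. It starts at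
the right end, where the whole carry is dropped. -/
theorem todaCarryBack_drop_gap (N : ℕ) (q e : ℕ → ℤ) (n : ℕ) :
    todaCarryBack N (todaDrop N q e) (todaGap N q e) n = todaCarry N q e n := by
  have base : ∀ n, N ≤ n + 1 →
      todaCarryBack N (todaDrop N q e) (todaGap N q e) n = todaCarry N q e n := by
    intro n h
    rw [todaCarryBack_of_le _ _ h, todaDrop, if_neg (by omega)]
  have key : ∀ j n, N ≤ n + 1 + j →
      todaCarryBack N (todaDrop N q e) (todaGap N q e) n = todaCarry N q e n := by
    intro j
    induction j with
    | zero => intro n h; exact base n h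
    | succ j ih =>
      intro n h
      by_cases hn : n + 1 < N
      · rw [todaCarryBack_of_lt _ _ hn, ih (n + 1) (by omega), todaCarry_succ]
        simp only [todaGap, todaDrop, if_pos hn]
        omega
      · exact base n (by omega)
  exact key N n (by omega)

theorem todaCarry_back (N : ℕ) (q e : ℕ → ℤ) (n : ℕ) :
    todaCarry N (todaDropBack N q e) (todaGapBack N q e) n = todaCarryBack N q e n := by
  induction n with
  | zero => rfl
  | succ n ih =>
    rw [todaCarry_succ, todaDrop, ih]
    by_cases hn : n + 1 < N
    · have := todaCarryBack_of_lt q e hn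
      simp only [todaGapBack, todaDropBack, if_pos hn]
      omega
    · simp only [todaDropBack, if_neg hn]
      omega

/-- The move of the balls of one index as a bijection. -/
def todaColumnEquiv (N : ℕ) : Equiv.Perm ((ℕ → ℤ) × (ℕ → ℤ)) where
  toFun x := (todaDrop N x.1 x.2, todaGap N x.1 x.2)
  invFun x := (todaDropBack N x.1 x.2, todaGapBack N x.1 x.2)
  left_inv := by
    rintro ⟨q, e⟩
    have h1 : todaDropBack N (todaDrop N q e) (todaGap N q e) = q := by
      funext n
      cases n with
      | zero => simp only [todaDropBack, todaCarryBack_drop_gap]; rfl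
      | succ n =>
        simp only [todaDropBack, todaCarryBack_drop_gap, todaCarry_succ]
        split_ifs with h
        · simp only [todaGap, todaDrop, if_pos h]
          omega
        · simp only [todaDrop, if_neg h]
          omega
    refine Prod.ext h1 (funext fun n => ?_)
    simp only [todaGapBack, h1, todaGap]
    split_ifs <;> omega
  right_inv := by
    rintro ⟨q, e⟩
    have h1 : todaDrop N (todaDropBack N q e) (todaGapBack N q e) = q := by
      funext n
      simp only [todaDrop, todaCarry_back]
      split_ifs with h
      · have := todaCarryBack_of_lt q e h
        simp only [todaGapBack, todaDropBack, if_pos h]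
        omega
      · exact todaCarryBack_of_le _ _ (by omega)
    refine Prod.ext h1 (funext fun n => ?_)
    simp only [todaGap, h1, todaGapBack]
    split_ifs <;> omega

/-- The autonomous ultradiscrete hungry Toda lattice: for every `k`, the balls of index `k` move
to the nearest empty boxes on their right and are given the index `k + M`. -/
structure IsHungryToda (M N : ℕ) (Q E d : ℤ → ℕ → ℤ) : Prop where
  carry_zero : ∀ k, d k 0 = Q k 0
  carry_succ : ∀ k n, d k (n + 1) = d k n - Q (k + M) n + Q k (n + 1)
  drop : ∀ k n, Q (k + M) n = if n + 1 < N then min (d k n) (E k n) else d k n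
  gap : ∀ k n, E (k + 1) n = if n + 1 < N then E k n - Q (k + M) n + Q k (n + 1) else E k n

/-- One step of the autonomous hungry Toda lattice on the data of `m + 1` consecutive indices. -/
def hungryTodaPerm (m N : ℕ) : Equiv.Perm ((Fin (m + 1) → ℕ → ℤ) × (ℕ → ℤ)) where
  toFun x := (Fin.snoc (Fin.tail x.1) (todaColumnEquiv N (x.1 0, x.2)).1,
    (todaColumnEquiv N (x.1 0, x.2)).2)
  invFun x := (Fin.cons ((todaColumnEquiv N).symm (x.1 (Fin.last m), x.2)).1 (Fin.init x.1),
    ((todaColumnEquiv N).symm (x.1 (Fin.last m), x.2)).2)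
  left_inv := by
    rintro ⟨q, e⟩
    simp [Fin.cons_self_tail]
  right_inv := by
    rintro ⟨q, e⟩
    simp

/-- Each step slides the window by one index, so the entries at `0` along the orbit determine the
whole family. -/
theorem hungryTodaPerm_zpow_apply (m N : ℕ) (x : (Fin (m + 1) → ℕ → ℤ) × (ℕ → ℤ)) (i : ℤ)
    (j : ℕ) (hj : j < m + 1) :
    ((hungryTodaPerm m N ^ (i + j)) x).1 0 = ((hungryTodaPerm m N ^ i) x).1 ⟨j, hj⟩ := by
  induction j generalizing i with
  | zero => simp
  | succ j ih =>
    have h := ih (i + 1) (by omega)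
    have h1 : i + ((j + 1 : ℕ) : ℤ) = i + 1 + j := by push_cast; ring
    rw [h1, h, add_comm i 1, zpow_add, zpow_one, Equiv.Perm.mul_apply]
    have h2 : (⟨j, by omega⟩ : Fin (m + 1)) = Fin.castSucc ⟨j, by omega⟩ := rfl
    change (Fin.snoc (α := fun _ => ℕ → ℤ) _ _ : Fin (m + 1) → ℕ → ℤ) _ = _
    rw [h2, Fin.snoc_castSucc]
    rfl

/-- The orbit of any data under the autonomous hungry Toda lattice, indexed so that the data
belong to the indices `1, …, m + 1`. -/
theorem isHungryToda_orbit (m N : ℕ) (x : (Fin (m + 1) → ℕ → ℤ) × (ℕ → ℤ)) :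
    IsHungryToda (m + 1) N (fun k => ((hungryTodaPerm m N ^ (k - 1)) x).1 0)
      (fun k => ((hungryTodaPerm m N ^ (k - 1)) x).2)
      (fun k => todaCarry N (((hungryTodaPerm m N ^ (k - 1)) x).1 0)
        ((hungryTodaPerm m N ^ (k - 1)) x).2) := by
  have hstep : ∀ k : ℤ, (hungryTodaPerm m N ^ (k + 1 - 1)) x =
      hungryTodaPerm m N ((hungryTodaPerm m N ^ (k - 1)) x) := by
    intro k
    rw [show k + 1 - 1 = 1 + (k - 1) by ring, zpow_add, zpow_one, Equiv.Perm.mul_apply]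
  have hQ : ∀ k : ℤ, ((hungryTodaPerm m N ^ (k + ((m + 1 : ℕ) : ℤ) - 1)) x).1 0 =
      todaDrop N (((hungryTodaPerm m N ^ (k - 1)) x).1 0)
        ((hungryTodaPerm m N ^ (k - 1)) x).2 := by
    intro k
    have h := hungryTodaPerm_zpow_apply m N x (k + 1 - 1) m (by omega)
    rw [show k + ((m + 1 : ℕ) : ℤ) - 1 = k + 1 - 1 + m by push_cast; ring, h, hstep]
    change (Fin.snoc (α := fun _ => ℕ → ℤ) _ _ : Fin (m + 1) → ℕ → ℤ) (Fin.last m) = _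
    rw [Fin.snoc_last]
    rfl
  refine ⟨fun k => rfl, fun k n => ?_, fun k n => ?_, fun k n => ?_⟩
  · rw [hQ, todaCarry_succ]
  · rw [hQ]; rfl
  · simp only [hQ, hstep]; rfl

theorem IsHungryToda.carry_eq {M N : ℕ} {Q E d : ℤ → ℕ → ℤ} (h : IsHungryToda M N Q E d)
    (k : ℤ) : d k = todaCarry N (Q k) (E k) := by
  funext n
  induction n with
  | zero => exact h.carry_zero k
  | succ n ih => rw [h.carry_succ, h.drop, todaCarry_succ, todaDrop, ih]

/-- A solution of the autonomous hungry Toda lattice is the orbit of its data. -/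
theorem IsHungryToda.eq_orbit {m N : ℕ} {Q E d : ℤ → ℕ → ℤ} (h : IsHungryToda (m + 1) N Q E d)
    (k : ℤ) :
    ((fun j : Fin (m + 1) => Q (k + (j : ℕ))), E k) =
      (hungryTodaPerm m N ^ (k - 1)) ((fun j : Fin (m + 1) => Q (1 + (j : ℕ))), E 1) := by
  have hdrop : ∀ k : ℤ, Q (k + ((m + 1 : ℕ) : ℤ)) = todaDrop N (Q k) (E k) := by
    intro k
    funext n
    rw [h.drop, todaDrop, h.carry_eq]
  have hstep : ∀ k : ℤ, hungryTodaPerm m N ((fun j : Fin (m + 1) => Q (k + (j : ℕ))), E k) =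
      ((fun j : Fin (m + 1) => Q (k + 1 + (j : ℕ))), E (k + 1)) := by
    intro k
    refine Prod.ext ?_ ?_
    · change (Fin.snoc (α := fun _ => ℕ → ℤ) _ _ : Fin (m + 1) → ℕ → ℤ) = _
      funext j
      refine Fin.lastCases ?_ (fun i => ?_) j
      · rw [Fin.snoc_last]
        change todaDrop N (Q (k + ((0 : ℕ) : ℤ))) (E k) = Q (k + 1 + (m : ℤ))
        rw [Nat.cast_zero, add_zero, ← hdrop]
        congr 1
        push_cast
        ring
      · rw [Fin.snoc_castSucc]
        simp only [Fin.tail, Fin.val_succ, Fin.val_castSucc]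
        congr 1
        push_cast
        ring
    · change todaGap N (Q (k + ((0 : ℕ) : ℤ))) (E k) = E (k + 1)
      funext n
      rw [Nat.cast_zero, add_zero, h.gap, hdrop]
      rfl
  have hone : ∀ i : ℤ,
      ((fun j : Fin (m + 1) => Q (i + 1 + (j : ℕ))), E (i + 1)) =
      (hungryTodaPerm m N ^ i) ((fun j : Fin (m + 1) => Q (1 + (j : ℕ))), E 1) := by
    intro i
    induction i using Int.induction_on with
    | zero => simp
    | succ i ih =>
      rw [← hstep, ih, add_comm (i : ℤ) 1, zpow_add, zpow_one, Equiv.Perm.mul_apply]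
    | pred i ih =>
      have h1 := hstep (-(i : ℤ) - 1 + 1)
      rw [show -(i : ℤ) - 1 + 1 + 1 = -i + 1 by ring, ih] at h1
      apply (hungryTodaPerm m N).injective
      rw [h1, ← Equiv.Perm.mul_apply]
      congr 1
      rw [← zpow_one_add]
      congr 1
      ring
  have := hone (k - 1)
  rwa [show k - 1 + 1 = k by ring] at this

/-! ### Finite capacity commutes with the autonomous lattice -/

/-- The excess of the carrier's load over its capacity. -/
def carrierExcess (M : ℕ) (S : ℤ) (D : ℤ → ℕ → ℤ) (k : ℤ) (n : ℕ) : ℤ :=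
  ∑ j ∈ Finset.range M, D (k + j) n - S

/-- The evolution of the data of the blocks under a carrier of capacity `S`. -/
structure IsCapacityEvolution (M N : ℕ) (S : ℤ) (Q E D Q' E' : ℤ → ℕ → ℤ) : Prop where
  load_zero : ∀ k, D k 0 = Q k 0
  load_succ : ∀ k n, D k (n + 1) = D k n - Q' k n + Q k (n + 1)
  drop : ∀ k n, Q' k n =
    if n + 1 < N then min (D k n) (E k n + max 0 (carrierExcess M S D k n)) else D k n
  gap : ∀ k n, E' k n =
    if n + 1 < N then min (E k n + max 0 (-carrierExcess M S D k n))
      (E (k + M) n + max 0 (carrierExcess M S D (k + M) n)) else E k n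

/-- The load of the carrier at the gap `n`, for all indices. -/
def capacityLoad (M N : ℕ) (S : ℤ) (Q E : ℤ → ℕ → ℤ) : ℕ → ℤ → ℤ
  | 0 => fun k => Q k 0
  | n + 1 => fun k => capacityLoad M N S Q E n k -
      (if n + 1 < N then min (capacityLoad M N S Q E n k)
        (E k n + max 0 (∑ j ∈ Finset.range M, capacityLoad M N S Q E n (k + j) - S))
      else capacityLoad M N S Q E n k) + Q k (n + 1)

theorem exists_isCapacityEvolution (M N : ℕ) (S : ℤ) (Q E : ℤ → ℕ → ℤ) :
    ∃ D Q' E', IsCapacityEvolution M N S Q E D Q' E' :=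
  ⟨fun k n => capacityLoad M N S Q E n k, _, _,
    fun _ => rfl, fun _ _ => rfl, fun _ _ => rfl, fun _ _ => rfl⟩

theorem carrierExcess_succ_index (M : ℕ) (S : ℤ) (D : ℤ → ℕ → ℤ) (k : ℤ) (n : ℕ) :
    carrierExcess M S D (k + 1) n = carrierExcess M S D k n - D k n + D (k + M) n := by
  have h := Finset.sum_range_succ (fun j : ℕ => D (k + j) n) M
  rw [Finset.sum_range_succ'] at h
  have h2 : ∑ j ∈ Finset.range M, D (k + ((j + 1 : ℕ) : ℤ)) n =
      ∑ j ∈ Finset.range M, D (k + 1 + j) n :=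
    Finset.sum_congr rfl fun j _ => by congr 1; push_cast; ring
  rw [h2] at h
  simp only [carrierExcess, Nat.cast_zero, add_zero] at h ⊢
  omega

/-- The carrier of the autonomous lattice on the evolved state. -/
def evolvedCarry (M : ℕ) (Q D Q' d : ℤ → ℕ → ℤ) (k : ℤ) (n : ℕ) : ℤ :=
  D (k + M) n - D k n + Q' k n + d k n - Q (k + M) n

/-- This identity and the next are the gap equation of the evolved state, with `F = F k n`, `G = Ẽ
(k + M) n`, `y` the evolved carry at `n`, `A = d k (n + 1)` and `e = E k (n + 1)`. The version
without `e` serves the case where site `n + 1` is the last. -/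
theorem min_gap_add_eq (F G A y : ℤ) :
    min (F + A - y) (G - min (min y F) G + A) =
      min F G - min (min y F) G + (A - max 0 (y - F)) := by
  rcases le_total F G with h1 | h1 <;> rcases le_total y F with h2 | h2 <;>
    rcases le_total y G with h3 | h3 <;> omega

theorem min_gap_add_min_eq (F G A e y : ℤ) :
    min (F + A - y) (G - min (min y F) G + min A e) =
      min F G - min (min y F) G + min (A - max 0 (y - F)) (e + max 0 (G - F)) := by
  rcases le_total F G with h1 | h1 <;> rcases le_total y F with h2 | h2 <;>
    rcases le_total y G with h3 | h3 <;> omega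

namespace IsCapacityEvolution

variable {M N : ℕ} {S : ℤ} {Q E D Q' E' d : ℤ → ℕ → ℤ}

theorem carrierExcess_succ (h : IsCapacityEvolution M N S Q E D Q' E') (k : ℤ) (n : ℕ) :
    carrierExcess M S D k (n + 1) = carrierExcess M S D k n -
      ∑ j ∈ Finset.range M, (Q' (k + j) n - Q (k + j) (n + 1)) := by
  simp only [carrierExcess, h.load_succ, Finset.sum_add_distrib, Finset.sum_sub_distrib]
  ring

/-- The recursion in the index of the variables `Ẽ` at the site `n`. -/
def IsCompatibleAt (M : ℕ) (S : ℤ) (Q E D Q' : ℤ → ℕ → ℤ) (n : ℕ) : Prop :=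
  ∀ k, E (k + 1) n + max 0 (carrierExcess M S D (k + 1) n) =
    E k n + max 0 (carrierExcess M S D k n) - Q' k n + Q k (n + 1)

theorem telescope {n : ℕ} (hc : IsCompatibleAt M S Q E D Q' n) (k : ℤ) (i : ℕ) :
    E (k + i) n + max 0 (carrierExcess M S D (k + i) n) =
      E k n + max 0 (carrierExcess M S D k n) -
        ∑ j ∈ Finset.range i, (Q' (k + j) n - Q (k + j) (n + 1)) := by
  induction i with
  | zero => simp
  | succ i ih =>
    have := hc (k + i)
    rw [Finset.sum_range_succ, show k + ((i + 1 : ℕ) : ℤ) = k + i + 1 by push_cast; ring]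
    omega

/-- Telescoping `Ẽ` over `M` consecutive indices produces the same sum as the change of `W` from `n`
to `n + 1`, and `max 0 W - max 0 (-W) = W`. This is what carries the formulas for `F` and `Ẽ` from
one site to the next. -/
theorem carrierExcess_succ_eq (h : IsCapacityEvolution M N S Q E D Q' E') {n : ℕ}
    (hc : IsCompatibleAt M S Q E D Q' n) (k : ℤ) :
    carrierExcess M S D k (n + 1) = (E (k + M) n + max 0 (carrierExcess M S D (k + M) n)) -
      (E k n + max 0 (-carrierExcess M S D k n)) := by
  rw [h.carrierExcess_succ, telescope hc]
  omega

theorem evolvedCarry_zero (h : IsCapacityEvolution M N S Q E D Q' E')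
    (hT : IsHungryToda M N Q E d) (k : ℤ) : evolvedCarry M Q D Q' d k 0 = Q' k 0 := by
  simp only [evolvedCarry, h.load_zero, hT.carry_zero]
  ring

theorem evolvedCarry_succ (h : IsCapacityEvolution M N S Q E D Q' E')
    (hT : IsHungryToda M N Q E d) (k : ℤ) (n : ℕ) : evolvedCarry M Q D Q' d k (n + 1) =
      evolvedCarry M Q D Q' d k n - Q' (k + M) n + Q' k (n + 1) := by
  simp only [evolvedCarry, h.load_succ, hT.carry_succ]
  ring

/-- The two claims need each other: compatibility at `n` expresses the excess at `n + 1` as `Ẽ (k +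
M) n - F k n`, after which both claims at `n + 1` are piecewise linear consequences of those at `n`.
-/
theorem invariant (h : IsCapacityEvolution M N S Q E D Q' E') (hT : IsHungryToda M N Q E d)
    (n : ℕ) (hn : n + 1 < N) :
    (∀ k, D (k + M) n = min (evolvedCarry M Q D Q' d k n)
      (E k n + max 0 (-carrierExcess M S D k n))) ∧ IsCompatibleAt M S Q E D Q' n := by
  induction n with
  | zero =>
    -- At site `0` the loads `D`, `d` and `Q` coincide. Since `max 0 W` and `max 0 (-W)` are never
    -- both positive, the minimum of the two capped gaps is `E k 0`.
    have key : ∀ k, D (k + M) 0 = min (D k 0) (E k 0) := by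
      intro k
      rw [h.load_zero, h.load_zero, hT.drop, if_pos hn, hT.carry_zero]
    refine ⟨fun k => ?_, fun k => ?_⟩
    · have h1 := key k
      have h2 := h.drop k 0
      rw [if_pos hn] at h2
      rw [h.evolvedCarry_zero hT]
      omega
    · have h1 := key k
      have h2 := h.drop k 0
      have h3 := hT.gap k 0
      have h4 := carrierExcess_succ_index M S D k 0
      have h5 := h.load_zero (k + M)
      rw [if_pos hn] at h2 h3
      omega
  | succ n ih =>
    obtain ⟨hb, hc⟩ := ih (by omega)
    have hn' : n + 1 < N := by omega
    refine ⟨fun k => ?_, fun k => ?_⟩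
    · have h1 := hb k
      have h2 := h.evolvedCarry_succ hT k n
      have h3 := h.drop k (n + 1)
      have h4 := h.carrierExcess_succ_eq hc k
      have h5 := h.drop (k + M) n
      have h6 := hT.drop k (n + 1)
      have h7 := h.load_succ (k + M) n
      have h8 := h.load_succ k n
      have h9 := hT.carry_succ k n
      have h10 : evolvedCarry M Q D Q' d k n =
        D (k + M) n - D k n + Q' k n + d k n - Q (k + M) n := rfl
      rw [if_pos hn] at h3 h6
      rw [if_pos hn'] at h5
      -- From here on the site `n` enters only through `F` and `G`, and the excess at `n + 1` is `G
      -- - F`.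
      generalize E k n + max 0 (-carrierExcess M S D k n) = F at *
      generalize E (k + M) n + max 0 (carrierExcess M S D (k + M) n) = G at *
      rw [h4] at h3 ⊢
      rw [h2]
      omega
    · have h1 := hb k
      have h3 := h.drop k (n + 1)
      have h4 := h.carrierExcess_succ_eq hc k
      have h5 := h.drop (k + M) n
      have h6 := hT.drop k (n + 1)
      have h7 := h.load_succ (k + M) n
      have h8 := h.load_succ k n
      have h9 := hT.carry_succ k n
      have h10 : evolvedCarry M Q D Q' d k n =
        D (k + M) n - D k n + Q' k n + d k n - Q (k + M) n := rfl
      have h11 := carrierExcess_succ_index M S D k (n + 1)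
      have h12 := hT.gap k (n + 1)
      rw [if_pos hn] at h3 h6 h12
      rw [if_pos hn'] at h5
      generalize E k n + max 0 (-carrierExcess M S D k n) = F at *
      generalize E (k + M) n + max 0 (carrierExcess M S D (k + M) n) = G at *
      rw [h4] at h3 ⊢
      rw [h4] at h11
      rw [h11, h12]
      omega

/-- The evolution under a carrier of finite capacity commutes with the autonomous lattice. -/
theorem isHungryToda (h : IsCapacityEvolution M N S Q E D Q' E') (hT : IsHungryToda M N Q E d) :
    IsHungryToda M N Q' E' (evolvedCarry M Q D Q' d) := by
  refine ⟨h.evolvedCarry_zero hT, h.evolvedCarry_succ hT, fun k n => ?_, fun k n => ?_⟩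
  · split_ifs with hn
    · have h1 := (h.invariant hT n hn).1 k
      have h5 := h.drop (k + M) n
      have h6 := h.gap k n
      rw [if_pos hn] at h5 h6
      omega
    · have h5 := h.drop (k + M) n
      have h6 := h.drop k n
      have h7 := hT.drop k n
      rw [if_neg hn] at h5 h6 h7
      simp only [evolvedCarry]
      omega
  · split_ifs with hn
    · obtain ⟨hb, hc⟩ := h.invariant hT n hn
      have h1 := hb k
      have h2 := hb (k + 1)
      have h3 := h.drop k (n + 1)
      have h4 := h.carrierExcess_succ_eq hc k
      have h5 := h.drop (k + M) n
      have h6 := hT.drop k (n + 1)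
      have h8 := h.load_succ k n
      have h9 := hT.carry_succ k n
      have h10 : evolvedCarry M Q D Q' d k n =
        D (k + M) n - D k n + Q' k n + d k n - Q (k + M) n := rfl
      have h11 := carrierExcess_succ_index M S D k n
      have h12 := hT.gap k n
      have h13 := h.gap k n
      have h14 := h.gap (k + 1) n
      have h15 := hc (k + M)
      have h16 := hc k
      rw [show k + M + 1 = k + 1 + M by ring] at h15
      rw [if_pos hn] at h5 h12 h13 h14
      -- The index recursion of `F`, obtained from those of `Ẽ` and `W` through `F = Ẽ - W`.
      have h17 : E (k + 1) n + max 0 (-carrierExcess M S D (k + 1) n) =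
        E k n + max 0 (-carrierExcess M S D k n) + d k (n + 1) -
          evolvedCarry M Q D Q' d k n := by
        have h18 : ∀ x : ℤ, max 0 (-x) = max 0 x - x := by omega
        rw [h18, h18]
        linarith
      rw [h15, h17] at h14
      clear h15 h16 h17 h11 h12 h2
      generalize E k n + max 0 (-carrierExcess M S D k n) = F at *
      generalize E (k + M) n + max 0 (carrierExcess M S D (k + M) n) = G at *
      generalize evolvedCarry M Q D Q' d k n = y at *
      -- By conservation the two carriers differ at `n + 1` by `y - D (k + M) n`, which is `y - min
      -- y F` by the invariant.
      have h18 : D k (n + 1) = d k (n + 1) - max 0 (y - F) := by omega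
      have h19 : Q' (k + M) n = min (min y F) G := by rw [h5, h1]
      rw [h4, h18] at h3
      rw [h13, h14, h3, h6, h19]
      split_ifs
      · exact min_gap_add_min_eq _ _ _ _ _
      · exact min_gap_add_eq _ _ _ _
    · have h1 := h.gap k n
      have h2 := h.gap (k + 1) n
      have h3 := hT.gap k n
      rw [if_neg hn] at h1 h2 h3
      omega

end IsCapacityEvolution

/-! ### The local rule of the box–ball system in linear order -/

theorem sum_range_cast_zmod (M : ℕ) (f : ZMod (M + 1) → ℕ) :
    ∑ j ∈ Finset.range (M + 1), f (j : ZMod (M + 1)) = ∑ k, f k := by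
  have h := Fin.sum_univ_eq_sum_range (fun j : ℕ => f (j : ZMod (M + 1))) (M + 1)
  rw [← h]
  exact Finset.sum_congr rfl fun k _ => congrArg f (ZMod.natCast_zmod_val (n := M + 1) k)

theorem sum_Icc_cast_zmod (M : ℕ) (f : ZMod (M + 1) → ℕ) :
    ∑ j ∈ Finset.Icc 1 (M + 1), f (j : ZMod (M + 1)) = ∑ k, f k := by
  rw [← sum_range_cast_zmod, Finset.sum_range_succ', ← Finset.Ico_add_one_right_eq_Icc,
    Finset.sum_Ico_eq_sum_range, Nat.add_sub_cancel, Finset.sum_range_succ]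
  congr 1
  · exact Finset.sum_congr rfl fun j _ => by rw [Nat.add_comm j 1]
  · congr 1
    rw [add_comm, ZMod.natCast_self, Nat.cast_zero]

theorem natCast_zmod_eq_iff (M : ℕ) {i j : ℕ} (hi : 1 ≤ i) (hi' : i ≤ M + 1) (hj : 1 ≤ j)
    (hj' : j ≤ M + 1) : (i : ZMod (M + 1)) = j ↔ i = j := by
  rw [ZMod.natCast_eq_natCast_iff]
  refine ⟨fun h => ?_, fun h => h ▸ rfl⟩
  rcases Nat.lt_or_ge i j with h1 | h1
  · have h2 := (Nat.modEq_iff_dvd' h1.le).1 h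
    have := Nat.le_of_dvd (by omega) h2
    omega
  · have h2 := (Nat.modEq_iff_dvd' h1).1 h.symm
    by_contra h3
    have := Nat.le_of_dvd (by omega) h2
    omega

theorem exists_natCast_zmod_eq (M : ℕ) (c : ZMod (M + 1)) :
    ∃ i : ℕ, 1 ≤ i ∧ i ≤ M + 1 ∧ (i : ZMod (M + 1)) = c := by
  have h1 := ZMod.natCast_zmod_val c
  have h2 := ZMod.val_lt c
  rcases Nat.eq_zero_or_pos c.val with h | h
  · refine ⟨M + 1, by omega, le_rfl, ?_⟩
    rw [ZMod.natCast_self, ← h1, h, Nat.cast_zero]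
  · exact ⟨c.val, h, h2.le, h1⟩

theorem exists_add_natCast_zmod_eq (M : ℕ) (c k : ZMod (M + 1)) :
    ∃ r : ℕ, 1 ≤ r ∧ r ≤ M + 1 ∧ c + r = k := by
  obtain ⟨r, h1, h2, h3⟩ := exists_natCast_zmod_eq M (k - c)
  exact ⟨r, h1, h2, by rw [h3]; ring⟩

/-- In the given range `M + 1` is the only multiple of `M + 1`. -/
theorem single_add_natCast (M : ℕ) (c : ZMod (M + 1)) {i : ℕ} (hi : 1 ≤ i) (hi' : i ≤ 2 * M + 1) :
    (Pi.single c 1 : ZMod (M + 1) → ℕ) (c + i) = if i = M + 1 then 1 else 0 := by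
  have key : c + (i : ZMod (M + 1)) = c ↔ i = M + 1 := by
    rw [add_eq_left, ZMod.natCast_eq_zero_iff]
    refine ⟨fun h => ?_, fun h => h ▸ dvd_rfl⟩
    obtain ⟨q, rfl⟩ := h
    rcases q with _ | _ | q
    · omega
    · omega
    · nlinarith
  simp only [Pi.single_apply, key]

/-- The box sum in term `i` reaches the content `c` exactly when `i < r - 1`, and then the term is
at least `1`. The other terms are pure carrier sums over growing sets, the smallest being that of `i
= r - 1`. Term `i = 0` supplies the bound `1`. -/
theorem bbsExchange_single (M : ℕ) (c : ZMod (M + 1)) (v : ZMod (M + 1) → ℕ) {r : ℕ}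
    (hr : 1 ≤ r) (hr' : r ≤ M + 1) :
    bbsExchange M (Pi.single c 1) v (c + r) =
      min 1 (∑ i ∈ Finset.Icc 1 (r - 1), v (c + i)) := by
  have hu : ∀ m ≤ M, ∑ j ∈ Finset.range m,
      (Pi.single c 1 : ZMod (M + 1) → ℕ) (c + r + (j : ZMod (M + 1))) =
      if M + 1 - r < m then 1 else 0 := by
    intro m hm
    have : ∀ j ∈ Finset.range m,
        (Pi.single c 1 : ZMod (M + 1) → ℕ) (c + r + (j : ZMod (M + 1))) =
        if M + 1 - r = j then 1 else 0 := by
      intro j hj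
      rw [Finset.mem_range] at hj
      rw [add_assoc, ← Nat.cast_add, single_add_natCast M c (by omega) (by omega)]
      congr 1
      exact propext ⟨fun _ => by omega, fun _ => by omega⟩
    rw [Finset.sum_congr rfl this, Finset.sum_ite_eq]
    simp
  have hv : ∑ j ∈ Finset.Icc (M - (r - 1) + 1) M, v (c + r + (j : ZMod (M + 1))) =
      ∑ i ∈ Finset.Icc 1 (r - 1), v (c + i) := by
    refine Finset.sum_nbij' (fun j => j - (M + 1 - r)) (fun i => i + (M + 1 - r)) ?_ ?_ ?_ ?_ ?_
    · intro j hj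
      simp only [Finset.mem_Icc] at hj ⊢
      omega
    · intro j hj
      simp only [Finset.mem_Icc] at hj ⊢
      omega
    · intro j hj
      simp only [Finset.mem_Icc] at hj
      omega
    · intro j hj
      simp only [Finset.mem_Icc] at hj
      omega
    · intro j hj
      simp only [Finset.mem_Icc] at hj
      congr 1
      rw [add_assoc, ← Nat.cast_add,
        show r + j = j - (M + 1 - r) + (M + 1) by omega, Nat.cast_add, ZMod.natCast_self, add_zero]
  unfold bbsExchange
  apply le_antisymm
  · apply le_min
    · refine (Finset.inf'_le _ (Finset.mem_range.2 (Nat.succ_pos M))).trans ?_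
      rw [Nat.sub_zero, Finset.Icc_eq_empty (by omega), Finset.sum_empty, hu M le_rfl]
      split_ifs <;> simp
    · refine (Finset.inf'_le _ (Finset.mem_range.2 (show r - 1 < M + 1 by omega))).trans ?_
      rw [hv, hu _ (by omega), if_neg (by omega), zero_add]
  · refine Finset.le_inf' _ _ fun i hi => ?_
    rw [Finset.mem_range] at hi
    rw [hu _ (by omega)]
    split_ifs with h
    · exact (min_le_left _ _).trans (Nat.le_add_right _ _)
    · rw [zero_add, ← hv]
      refine (min_le_right _ _).trans (Finset.sum_le_sum_of_subset ?_)
      exact Finset.Icc_subset_Icc (by omega) le_rfl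

theorem eq_single_of_sum_eq_one {ι : Type*} [Fintype ι] [DecidableEq ι] {f : ι → ℕ}
    (hf : ∑ i, f i = 1) {c : ι} (hc : f c = 1) : f = Pi.single c 1 := by
  funext k
  rw [Pi.single_apply]
  split_ifs with h
  · rw [h, hc]
  · have := Finset.add_sum_erase Finset.univ f (Finset.mem_univ c)
    have h2 : ∑ i ∈ Finset.univ.erase c, f i = 0 := by omega
    exact Finset.sum_eq_zero_iff.1 h2 k (Finset.mem_erase.2 ⟨h, Finset.mem_univ k⟩)

theorem exists_eq_one_of_sum_eq_one {ι : Type*} [Fintype ι] {f : ι → ℕ}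
    (hf : ∑ i, f i = 1) : ∃ c, f c = 1 := by
  obtain ⟨c, -, hc⟩ := Finset.exists_ne_zero_of_sum_ne_zero (hf ▸ one_ne_zero)
  have := Finset.single_le_sum (fun i _ => Nat.zero_le (f i)) (Finset.mem_univ c)
  exact ⟨c, by omega⟩

/-- A carrier that loads the content `c` of a box unloads the first item that it holds in the
cyclic order `c + 1, c + 2, …, c`. -/
theorem exists_unloaded {M : ℕ} {c : ZMod (M + 1)} {u' v : ZMod (M + 1) → ℕ}
    (hu : ∀ k, u' k + bbsExchange M (Pi.single c 1) v k =
      (Pi.single c 1 : ZMod (M + 1) → ℕ) k + bbsExchange M (Pi.single c 1) v (k + 1))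
    (hsum : ∑ k, u' k = 1) (hv : 0 < ∑ k, v k) :
    ∃ r : ℕ, 1 ≤ r ∧ r ≤ M + 1 ∧ u' = Pi.single (c + r) 1 ∧ 0 < v (c + r) ∧
      ∀ i, 1 ≤ i → i < r → v (c + i) = 0 := by
  have hex : ∃ r : ℕ, 1 ≤ r ∧ 0 < v (c + r) := by
    obtain ⟨k, -, hk⟩ := Finset.exists_ne_zero_of_sum_ne_zero hv.ne'
    obtain ⟨r, h1, -, rfl⟩ := exists_add_natCast_zmod_eq M c k
    exact ⟨r, h1, Nat.pos_of_ne_zero hk⟩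
  classical
  obtain ⟨h1, h2⟩ := Nat.find_spec hex
  have hmin : ∀ i, 1 ≤ i → i < Nat.find hex → v (c + i) = 0 := by
    intro i hi hlt
    by_contra hne
    exact Nat.find_min hex hlt ⟨hi, Nat.pos_of_ne_zero hne⟩
  have hle : Nat.find hex ≤ M + 1 := by
    obtain ⟨r, hr, hr', h⟩ := exists_add_natCast_zmod_eq M c (c + (Nat.find hex : ℕ))
    exact (Nat.find_min' hex ⟨hr, by rw [h]; exact h2⟩).trans hr'
  generalize Nat.find hex = r at *
  refine ⟨r, h1, hle, eq_single_of_sum_eq_one hsum ?_, h2, hmin⟩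
  -- Nothing is held before `c + r`, so the exchange vanishes at `c + r`. At `c + r + 1` it is `1`,
  -- unless `r = M + 1`; then it wraps around to an empty sum and the loaded item itself supplies
  -- the `1`.
  have hz : ∑ i ∈ Finset.Icc 1 (r - 1), v (c + i) = 0 :=
    Finset.sum_eq_zero fun i hi => by
      rw [Finset.mem_Icc] at hi
      exact hmin i hi.1 (by omega)
  have hk := hu (c + r)
  rw [bbsExchange_single M c v h1 hle, hz, single_add_natCast M c h1 (by omega)] at hk
  rcases Nat.lt_or_ge r (M + 1) with h | h
  · rw [add_assoc, ← Nat.cast_add_one, bbsExchange_single M c v (by omega) (by omega),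
      if_neg (by omega)] at hk
    have : v (c + r) ≤ ∑ i ∈ Finset.Icc 1 (r + 1 - 1), v (c + i) :=
      Finset.single_le_sum (f := fun i : ℕ => v (c + i)) (fun i _ => Nat.zero_le _)
        (Finset.mem_Icc.2 ⟨h1, by omega⟩)
    omega
  · have hr : r = M + 1 := by omega
    have hc : c + (r : ZMod (M + 1)) + 1 = c + ((1 : ℕ) : ZMod (M + 1)) := by
      rw [hr, ZMod.natCast_self, add_zero, Nat.cast_one]
    rw [hc, bbsExchange_single M c v le_rfl (by omega)] at hk
    simpa [hr] using hk

/-- A carrier with `S` places passes through the boxes. The letters are `1, …, L`, the last of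
which stands for an empty place; `w n` and `w' n` are the contents of the box `n` before and after
the passage, and `C n k` is the number of letters `k` in the carrier when it reaches the box `n`.
Loading the letter `w n`, the carrier unloads the smallest larger letter, or, if there is none, the
smallest letter of all. -/
structure IsCarrierPass (L S : ℕ) (w w' : ℤ → ℕ) (C : ℤ → ℕ → ℕ) : Prop where
  mem : ∀ n, 1 ≤ w n ∧ w n ≤ L
  mem' : ∀ n, 1 ≤ w' n ∧ w' n ≤ L
  present : ∀ n, 0 < C n (w' n)
  step : ∀ n k, 1 ≤ k → k ≤ L →
    C (n + 1) k + (if w' n = k then 1 else 0) = C n k + if w n = k then 1 else 0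
  bump : ∀ n, w n < w' n → ∀ j, w n < j → j < w' n → C n j = 0
  pop_above : ∀ n, w' n ≤ w n → ∀ j, w n < j → j ≤ L → C n j = 0
  pop_below : ∀ n, w' n ≤ w n → ∀ j, 1 ≤ j → j < w' n → C n j = 0
  total : ∀ n, ∑ k ∈ Finset.Icc 1 L, C n k = S

namespace IsBoxBallSystem

variable {M : ℕ} {S : ℤ → ℕ} {U V : ZMod (M + 1) → ℤ → ℤ → ℕ}

/-- Summed over the cyclic index, the two exchange terms cancel, so the initial condition spreads to
all times in both directions. -/
theorem sum_box (h : IsBoxBallSystem M S U V) (t n : ℤ) : ∑ k, U k t n = 1 := by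
  have hstep : ∀ t, ∑ k, U k (t + 1) n = ∑ k, U k t n := by
    intro t
    have h1 := Finset.sum_congr rfl fun k (_ : k ∈ Finset.univ) => h.box_evolution k t n
    rw [Finset.sum_add_distrib, Finset.sum_add_distrib] at h1
    have h2 := Equiv.sum_comp (Equiv.addRight (1 : ZMod (M + 1)))
      (bbsExchange M (fun i => U i t n) (fun i => V i t n))
    simp only [Equiv.coe_addRight] at h2
    omega
  have h0 : ∑ k, U k 0 n = 1 := by
    exact (sum_range_cast_zmod M fun k => U k 0 n).symm.trans (h.initial n)
  induction t using Int.induction_on with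
  | zero => exact h0
  | succ t ih => rw [hstep, ih]
  | pred t ih =>
    have := hstep (-(t : ℤ) - 1)
    rw [sub_add_cancel] at this
    rw [← this, ih]

theorem sum_carrier (h : IsBoxBallSystem M S U V) (t n : ℤ) : ∑ k, V k t n = S t := by
  have hstep : ∀ n, ∑ k, V k t (n + 1) = ∑ k, V k t n := by
    intro n
    have h1 := Finset.sum_congr rfl fun k (_ : k ∈ Finset.univ) => h.carrier_evolution k t n
    rw [Finset.sum_add_distrib, Finset.sum_add_distrib] at h1
    have h2 := Equiv.sum_comp (Equiv.addRight (1 : ZMod (M + 1)))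
      (bbsExchange M (fun i => U i t n) (fun i => V i t n))
    simp only [Equiv.coe_addRight] at h2
    omega
  have hconst : ∀ n, ∑ k, V k t n = ∑ k, V k t 0 := by
    intro n
    induction n using Int.induction_on with
    | zero => rfl
    | succ n ih => rw [hstep, ih]
    | pred n ih =>
      have := hstep (-(n : ℤ) - 1)
      rw [sub_add_cancel] at this
      rw [← this, ih]
  obtain ⟨n₀, hn₀⟩ := h.boundary t
  obtain ⟨-, h2, h3⟩ := hn₀ |n₀| (by rw [abs_abs]; exact le_abs_self _)
  rw [hconst, ← hconst |n₀|, ← h2]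
  exact Fintype.sum_eq_single 0 fun k hk => (h3 k hk).2

/-- The contents of the boxes as letters `1, …, M + 1`, the last of which stands for an empty
box. -/
theorem exists_letter (h : IsBoxBallSystem M S U V) : ∃ w : ℤ → ℤ → ℕ, ∀ t n,
    1 ≤ w t n ∧ w t n ≤ M + 1 ∧ (fun k => U k t n) = Pi.single (w t n : ZMod (M + 1)) 1 := by
  have : ∀ t n, ∃ l : ℕ, 1 ≤ l ∧ l ≤ M + 1 ∧
      (fun k => U k t n) = Pi.single (l : ZMod (M + 1)) 1 := by
    intro t n
    obtain ⟨c, hc⟩ := exists_eq_one_of_sum_eq_one (h.sum_box t n)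
    obtain ⟨l, h1, h2, rfl⟩ := exists_natCast_zmod_eq M c
    exact ⟨l, h1, h2, eq_single_of_sum_eq_one (h.sum_box t n) hc⟩
  choose w hw using this
  exact ⟨w, hw⟩

theorem box_eq_ite {w : ℤ → ℤ → ℕ} (hw : ∀ t n, 1 ≤ w t n ∧ w t n ≤ M + 1 ∧
      (fun k => U k t n) = Pi.single (w t n : ZMod (M + 1)) 1) (t n : ℤ) {k : ℕ} (h1 : 1 ≤ k)
    (h2 : k ≤ M + 1) : U (k : ZMod (M + 1)) t n = if w t n = k then 1 else 0 := by
  obtain ⟨h3, h4, h5⟩ := hw t n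
  rw [show U k t n = (fun k => U k t n) (k : ZMod (M + 1)) from rfl, h5, Pi.single_apply]
  simp only [natCast_zmod_eq_iff M h1 h2 h3 h4, eq_comm]

/-- The cyclic order beginning after `w` runs through `w + 1, …, M + 1` and then `1, …, w`:
unloading before the wrap is a bump, after it a pop. -/
theorem isCarrierPass (h : IsBoxBallSystem M S U V) (hS : ∀ t, 0 < S t) {w : ℤ → ℤ → ℕ}
    (hw : ∀ t n, 1 ≤ w t n ∧ w t n ≤ M + 1 ∧
      (fun k => U k t n) = Pi.single (w t n : ZMod (M + 1)) 1) (t : ℤ) :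
    IsCarrierPass (M + 1) (S t) (w t) (w (t + 1)) (fun n k => V (k : ZMod (M + 1)) t n) := by
  have hmain : ∀ n, ∃ r : ℕ, 1 ≤ r ∧ r ≤ M + 1 ∧
      (w (t + 1) n = w t n + r ∨ w (t + 1) n + (M + 1) = w t n + r) ∧
      0 < V (w (t + 1) n : ZMod (M + 1)) t n ∧
      ∀ i, 1 ≤ i → i < r → V ((w t n + i : ℕ) : ZMod (M + 1)) t n = 0 := by
    intro n
    have hev : ∀ k, U k (t + 1) n + _ = U k t n + _ := fun k => h.box_evolution k t n
    obtain ⟨h1, h2, h3⟩ := hw t n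
    obtain ⟨h1', h2', h3'⟩ := hw (t + 1) n
    rw [h3] at hev
    simp only [show ∀ k, U k t n = (Pi.single (w t n : ZMod (M + 1)) 1 : ZMod (M + 1) → ℕ) k from
      fun k => congrFun h3 k] at hev
    obtain ⟨r, hr, hr', hu, hpos, hz⟩ := exists_unloaded (u' := fun k => U k (t + 1) n) hev
      (h.sum_box (t + 1) n) (by rw [h.sum_carrier]; exact hS t)
    have hcast : ((w t n + r : ℕ) : ZMod (M + 1)) = (w (t + 1) n : ZMod (M + 1)) := by
      have h4 := congrFun (hu.symm.trans h3') ((w t n : ZMod (M + 1)) + r)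
      rw [Pi.single_eq_same, Pi.single_apply] at h4
      rw [Nat.cast_add]
      by_contra hne
      rw [if_neg hne] at h4
      exact one_ne_zero h4
    refine ⟨r, hr, hr', ?_, ?_, fun i hi hi' => by rw [Nat.cast_add]; exact hz i hi hi'⟩
    · rcases Nat.lt_or_ge (M + 1) (w t n + r) with hlt | hge
      · right
        have h5 : ((w t n + r - (M + 1) : ℕ) : ZMod (M + 1)) = (w (t + 1) n : ZMod (M + 1)) := by
          rw [← hcast, ← add_zero (((w t n + r - (M + 1) : ℕ) : ZMod (M + 1))),
            ← ZMod.natCast_self (M + 1), ← Nat.cast_add]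
          congr 1
          omega
        have := (natCast_zmod_eq_iff M (by omega) (by omega) h1' h2').1 h5
        omega
      · left
        exact ((natCast_zmod_eq_iff M (by omega) hge h1' h2').1 hcast).symm
    · rw [← hcast, Nat.cast_add]
      exact hpos
  refine ⟨fun n => ⟨(hw t n).1, (hw t n).2.1⟩, fun n => ⟨(hw (t + 1) n).1, (hw (t + 1) n).2.1⟩,
    fun n => ?_, fun n k h1 h2 => ?_, fun n hlt j h1 h2 => ?_, fun n hle j h1 h2 => ?_,
    fun n hle j h1 h2 => ?_, fun n => ?_⟩
  · obtain ⟨r, -, -, -, h4, -⟩ := hmain n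
    exact h4
  · have e1 := h.box_evolution k t n
    have e2 := h.carrier_evolution k t n
    rw [box_eq_ite hw _ _ h1 h2, box_eq_ite hw _ _ h1 h2] at e1
    omega
  · obtain ⟨r, h4, h5, h6, -, h7⟩ := hmain n
    have := (hw (t + 1) n).1
    have h8 := h7 (j - w t n) (by omega) (by omega)
    rwa [show w t n + (j - w t n) = j by omega] at h8
  · obtain ⟨r, h4, h5, h6, -, h7⟩ := hmain n
    have := (hw (t + 1) n).1
    have h8 := h7 (j - w t n) (by omega) (by omega)
    rwa [show w t n + (j - w t n) = j by omega] at h8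
  · obtain ⟨r, h4, h5, h6, -, h7⟩ := hmain n
    have := (hw t n).2.1
    have h8 := h7 (j + (M + 1) - w t n) (by omega) (by omega)
    rwa [show w t n + (j + (M + 1) - w t n) = j + (M + 1) by omega, Nat.cast_add,
      ZMod.natCast_self, add_zero] at h8
  · rw [sum_Icc_cast_zmod M fun k => V k t n]
    exact h.sum_carrier t n

end IsBoxBallSystem

/-! ### Letter counts, descents and runs -/

/-- The number of boxes `x, …, y - 1` that contain the letter `k`. -/
noncomputable def letterCount (w : ℤ → ℕ) (k : ℕ) (x y : ℤ) : ℤ :=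
  ∑ m ∈ Finset.Ico x y, if w m = k then 1 else 0

theorem sum_Ico_add_sum_Ico_int (f : ℤ → ℤ) {x y z : ℤ} (hxy : x ≤ y) (hyz : y ≤ z) :
    ∑ m ∈ Finset.Ico x y, f m + ∑ m ∈ Finset.Ico y z, f m = ∑ m ∈ Finset.Ico x z, f m := by
  rw [← Finset.sum_union (Finset.Ico_disjoint_Ico_consecutive x y z),
    Finset.Ico_union_Ico_eq_Ico hxy hyz]

theorem letterCount_add (w : ℤ → ℕ) (k : ℕ) {x y z : ℤ} (hxy : x ≤ y) (hyz : y ≤ z) :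
    letterCount w k x y + letterCount w k y z = letterCount w k x z :=
  sum_Ico_add_sum_Ico_int _ hxy hyz

theorem letterCount_self (w : ℤ → ℕ) (k : ℕ) (x : ℤ) : letterCount w k x x = 0 := by
  simp [letterCount]

theorem letterCount_succ (w : ℤ → ℕ) (k : ℕ) {x y : ℤ} (hxy : x ≤ y) :
    letterCount w k x (y + 1) = letterCount w k x y + if w y = k then 1 else 0 := by
  rw [← letterCount_add w k hxy (by omega : y ≤ y + 1)]
  have h1 : Finset.Ico y (y + 1) = {y} := by
    ext m
    simp only [Finset.mem_Ico, Finset.mem_singleton]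
    omega
  rw [letterCount, letterCount, h1, Finset.sum_singleton]

theorem letterCount_nonneg (w : ℤ → ℕ) (k : ℕ) (x y : ℤ) : 0 ≤ letterCount w k x y :=
  Finset.sum_nonneg fun m _ => by split_ifs <;> simp

theorem letterCount_eq_zero {w : ℤ → ℕ} {k : ℕ} {x y : ℤ}
    (h : ∀ m, x ≤ m → m < y → w m ≠ k) : letterCount w k x y = 0 :=
  Finset.sum_eq_zero fun m hm => by
    rw [Finset.mem_Ico] at hm
    rw [if_neg (h m hm.1 hm.2)]

theorem letterCount_eq_length {w : ℤ → ℕ} {k : ℕ} {x y : ℤ} (hxy : x ≤ y)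
    (h : ∀ m, x ≤ m → m < y → w m = k) : letterCount w k x y = y - x := by
  rw [letterCount, Finset.sum_congr rfl (g := fun _ => 1) fun m hm => by
    rw [Finset.mem_Ico] at hm
    rw [if_pos (h m hm.1 hm.2)]]
  simp [hxy]

theorem sum_letterCount (w : ℤ → ℕ) (hw : ∀ m, 1 ≤ w m) (k : ℕ) (x y : ℤ) :
    ∑ j ∈ Finset.Icc 1 k, letterCount w j x y =
      ∑ m ∈ Finset.Ico x y, if w m ≤ k then 1 else 0 := by
  simp only [letterCount]
  rw [Finset.sum_comm]
  refine Finset.sum_congr rfl fun m _ => ?_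
  rw [Finset.sum_ite_eq]
  simp only [Finset.mem_Icc, hw m, true_and]

theorem sum_letterCount_eq_length {w : ℤ → ℕ} (hw : ∀ m, 1 ≤ w m) {k : ℕ} {x y : ℤ}
    (hxy : x ≤ y) (hk : ∀ m, w m ≤ k) :
    ∑ j ∈ Finset.Icc 1 k, letterCount w j x y = y - x := by
  rw [sum_letterCount w hw]
  simp [hk, hxy]

theorem le_of_forall_not_descent {w : ℤ → ℕ} {x y : ℤ} (hxy : x ≤ y)
    (h : ∀ m, x < m → m ≤ y → ¬ w m < w (m - 1)) : w x ≤ w y := by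
  induction y, hxy using Int.leInduction with
  | base => exact le_rfl
  | succ y hxy ih =>
    have h1 := ih fun m h2 h3 => h m h2 (by omega)
    have h2 := h (y + 1) (by omega) le_rfl
    rw [add_sub_cancel_right] at h2
    omega

/-- `p 0 < ⋯ < p (N - 1)` are the positions where the sequence of letters `w` descends, and
`p N` lies to the right of everything that happens. -/
structure IsRunPartition (L N : ℕ) (w : ℤ → ℕ) (p : ℕ → ℤ) : Prop where
  le_top : ∀ m, w m ≤ L
  lt_succ : ∀ n, n < N → p n < p (n + 1)
  descent_iff : ∀ m, w m < w (m - 1) ↔ ∃ n, n < N ∧ p n = m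
  top_right : ∀ m, p N ≤ m + 1 → w m = L
  top_left : ∃ m₀, ∀ m, m ≤ m₀ → w m = L

theorem exists_run {N : ℕ} {p : ℕ → ℤ} {x : ℤ} (hx : p 0 ≤ x) (hx' : x < p N) :
    ∃ n, n < N ∧ p n ≤ x ∧ x < p (n + 1) := by
  induction N with
  | zero => omega
  | succ N ih =>
    rcases lt_or_ge x (p N) with h1 | h1
    · obtain ⟨n, h2, h3⟩ := ih h1
      exact ⟨n, by omega, h3⟩
    · exact ⟨N, by omega, h1, hx'⟩

namespace IsRunPartition

variable {L N : ℕ} {w : ℤ → ℕ} {p : ℕ → ℤ}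

theorem strictMono (h : IsRunPartition L N w p) {i j : ℕ} (hij : i < j) (hj : j ≤ N) :
    p i < p j := by
  induction j, hij using Nat.le_induction with
  | base => exact h.lt_succ i hj
  | succ j hij ih => exact (ih (by omega)).trans (h.lt_succ j hj)

theorem mono (h : IsRunPartition L N w p) {i j : ℕ} (hij : i ≤ j) (hj : j ≤ N) : p i ≤ p j := by
  rcases hij.eq_or_lt with rfl | hlt
  · exact le_rfl
  · exact (h.strictMono hlt hj).le

theorem not_descent (h : IsRunPartition L N w p) {n : ℕ} (hn : n < N) {m : ℤ} (h1 : p n < m)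
    (h2 : m < p (n + 1)) : ¬ w m < w (m - 1) := by
  rw [h.descent_iff]
  rintro ⟨i, hi, rfl⟩
  rcases Nat.lt_or_ge n i with h3 | h3
  · have := h.mono (show n + 1 ≤ i from h3) hi.le
    omega
  · have := h.mono h3 hn.le
    omega

theorem le_of_mem_run (h : IsRunPartition L N w p) {n : ℕ} (hn : n < N) {x y : ℤ}
    (hx : p n ≤ x) (hxy : x ≤ y) (hy : y < p (n + 1)) : w x ≤ w y :=
  le_of_forall_not_descent hxy fun _ h1 h2 => h.not_descent hn (by omega) (by omega)

theorem eq_top_of_lt (h : IsRunPartition L N w p) {x : ℤ} (hx : x < p 0) : w x = L := by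
  obtain ⟨m₀, hm₀⟩ := h.top_left
  rcases le_total x m₀ with h1 | h1
  · exact hm₀ x h1
  · apply le_antisymm (h.le_top x)
    rw [← hm₀ m₀ le_rfl]
    refine le_of_forall_not_descent h1 fun m h2 h3 => ?_
    rw [h.descent_iff]
    rintro ⟨i, hi, rfl⟩
    have := h.mono (Nat.zero_le i) hi.le
    omega

theorem lt_top (h : IsRunPartition L N w p) {n : ℕ} (hn : n < N) : w (p n) < L :=
  ((h.descent_iff (p n)).2 ⟨n, hn, rfl⟩).trans_le (h.le_top _)

/-- The enumeration of the descents is unique. -/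
theorem unique {N' : ℕ} {p' : ℕ → ℤ} (h : IsRunPartition L N w p)
    (h' : IsRunPartition L N' w p') : N = N' ∧ ∀ n, n < N → p n = p' n := by
  -- Both enumerations stay quantified so that they can change roles in the induction.
  have key : ∀ n, ∀ N N' : ℕ, ∀ p p' : ℕ → ℤ, IsRunPartition L N w p →
      IsRunPartition L N' w p' → n < N → n < N' ∧ p' n ≤ p n → n < N' ∧ p n = p' n := by
    intro n
    induction n using Nat.strong_induction_on with
    | _ n ih =>
      intro N N' p p' h h' hn hn'
      refine ⟨hn'.1, ?_⟩
      obtain ⟨i, hi, hpi⟩ := (h.descent_iff (p' n)).1 ((h'.descent_iff (p' n)).2 ⟨n, hn'.1, rfl⟩)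
      rcases lt_trichotomy i n with h1 | h1 | h1
      · have h2 : p i = p' i ∨ p' i < p i ∨ p i < p' i := by omega
        rcases h2 with h2 | h2 | h2
        · have := h'.strictMono h1 hn'.1.le
          omega
        · have h3 := ih i h1 N N' p p' h h' hi ⟨by omega, h2.le⟩
          omega
        · have h3 := ih i h1 N' N p' p h' h (by omega) ⟨by omega, h2.le⟩
          omega
      · rw [← h1, hpi, h1]
      · have := h.strictMono h1 hi.le
        omega
  have hlt : ∀ n, ∀ N N' : ℕ, ∀ p p' : ℕ → ℤ, IsRunPartition L N w p →
      IsRunPartition L N' w p' → n < N → n < N' := by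
    intro n
    induction n with
    | zero =>
      intro N N' p p' h h' hn
      obtain ⟨i, hi, -⟩ := (h'.descent_iff (p 0)).1 ((h.descent_iff (p 0)).2 ⟨0, hn, rfl⟩)
      omega
    | succ n ih =>
      intro N N' p p' h h' hn
      have h1 := ih N N' p p' h h' (by omega)
      obtain ⟨i, hi, hpi⟩ :=
        (h'.descent_iff (p (n + 1))).1 ((h.descent_iff (p (n + 1))).2 ⟨n + 1, hn, rfl⟩)
      have h2 : p n = p' n := by
        rcases le_total (p' n) (p n) with h3 | h3
        · exact (key n N N' p p' h h' (by omega) ⟨h1, h3⟩).2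
        · exact (key n N' N p' p h' h h1 ⟨by omega, h3⟩).2.symm
      have h3 := h.lt_succ n (by omega)
      rcases Nat.lt_or_ge n i with h4 | h4
      · omega
      · have := h'.mono h4 h1.le
        omega
  have hN : N = N' := by
    apply le_antisymm
    · by_contra h1
      exact lt_irrefl _ (hlt N' N N' p p' h h' (by omega))
    · by_contra h1
      exact lt_irrefl _ (hlt N N' N p' p h' h (by omega))
  refine ⟨hN, fun n hn => ?_⟩
  rcases le_total (p' n) (p n) with h3 | h3
  · exact (key n N N' p p' h h' hn ⟨by omega, h3⟩).2
  · exact (key n N' N p' p h' h (by omega) ⟨hn, h3⟩).2.symm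

end IsRunPartition

/-- A sequence of letters that is trivial far away has a run partition. -/
theorem exists_isRunPartition {L : ℕ} {w : ℤ → ℕ} (hL : ∀ m, w m ≤ L) {B : ℤ}
    (hB : ∀ m, B ≤ |m| → w m = L) : ∃ N p, IsRunPartition L N w p ∧ p N = |B| + 1 := by
  classical
  let P : Finset ℤ := (Finset.Ioo (-(|B| + 1)) (|B| + 1)).filter fun m => w m < w (m - 1)
  let f := P.orderEmbOfFin rfl
  have hmem : ∀ i, -(|B| + 1) < f i ∧ f i < |B| + 1 ∧ w (f i) < w (f i - 1) := by
    intro i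
    have := Finset.orderEmbOfFin_mem P rfl i
    simpa only [P, Finset.mem_filter, Finset.mem_Ioo, and_assoc] using this
  -- With `p N = |B| + 1`, the box `p N - 1` is already empty. The condition `p N ≤ m + 1` in
  -- `top_right` includes this box, and it keeps the last phase cut strictly before `p N`.
  refine ⟨P.card, fun n => if h : n < P.card then f ⟨n, h⟩ else |B| + 1, ⟨hL, ?_, ?_, ?_, ?_⟩, ?_⟩
  · intro n hn
    simp only [dif_pos hn]
    split_ifs with h
    · exact f.strictMono (by simp)
    · exact (hmem _).2.1
  · intro m
    constructor
    · intro hm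
      have h1 : ¬ B ≤ |m| := by
        intro h2
        rw [hB m h2] at hm
        exact absurd (hL (m - 1)) (by omega)
      have h2 : m ∈ P := by
        simp only [P, Finset.mem_filter, Finset.mem_Ioo]
        have := le_abs_self B
        have := neg_le_abs m
        have := le_abs_self m
        exact ⟨⟨by omega, by omega⟩, hm⟩
      have h3 : m ∈ Set.range f := by
        rw [Finset.range_orderEmbOfFin]
        exact h2
      obtain ⟨i, rfl⟩ := h3
      exact ⟨i, i.2, by simp⟩
    · rintro ⟨n, hn, rfl⟩
      simp only [dif_pos hn]
      exact (hmem _).2.2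
  · intro m hm
    rw [dif_neg (lt_irrefl _)] at hm
    have := le_abs_self B
    have := le_abs_self m
    exact hB m (by omega)
  · refine ⟨-|B|, fun m hm => hB m ?_⟩
    have := le_abs_self B
    have := neg_le_abs m
    omega
  · simp

/-! ### Passage of the carrier through the runs -/

/-- The contents `q k n` (`1 ≤ k ≤ M`) of the blocks and the lengths `e n` of the gaps between them
evolve into `q'` and `e'` under the passage of a carrier of capacity `S`. -/
structure IsBlockEvolution (M N : ℕ) (S : ℤ) (q : ℕ → ℕ → ℤ) (e : ℕ → ℤ) (q' : ℕ → ℕ → ℤ)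
    (e' : ℕ → ℤ) (D : ℕ → ℕ → ℤ) : Prop where
  load_zero : ∀ k, 1 ≤ k → k ≤ M → 0 < N → D k 0 = q k 0
  load_succ : ∀ k n, 1 ≤ k → k ≤ M → n + 1 < N → D k (n + 1) = D k n - q' k n + q k (n + 1)
  last : ∀ k n, 1 ≤ k → k ≤ M → n + 1 = N → q' k n = D k n
  drop : ∀ i n, i < M → n + 1 < N → q' (i + 1) n = min (D (i + 1) n)
    (e n + max 0 (∑ j ∈ Finset.Icc 1 M, D j n - S) +
      ∑ j ∈ Finset.Icc 1 i, q j (n + 1) - ∑ j ∈ Finset.Icc 1 i, q' j n)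
  gap : ∀ n, n + 1 < N → e' n = min (e n + max 0 (S - ∑ j ∈ Finset.Icc 1 M, D j n))
    (e n + max 0 (∑ j ∈ Finset.Icc 1 M, D j n - S) +
      ∑ j ∈ Finset.Icc 1 M, q j (n + 1) - ∑ j ∈ Finset.Icc 1 M, q' j n)

/-- Every run `p n, …, p (n + 1) - 1` is cut at `s n` into a phase in which the carrier unloads
larger letters than it loads and a phase in which it does not. -/
structure IsPhaseCut (N : ℕ) (w w' : ℤ → ℕ) (p s : ℕ → ℤ) : Prop where
  lt : ∀ n, n < N → p n < s n
  le : ∀ n, n < N → s n ≤ p (n + 1)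
  last : s N = p N
  lt_last : ∀ n, n + 1 = N → s n < p N
  bump : ∀ n, n < N → ∀ m, p n ≤ m → m < s n → w m < w' m
  pop : ∀ n, n < N → ∀ m, s n ≤ m → m < p (n + 1) → w' m ≤ w m

namespace IsCarrierPass

variable {L S N : ℕ} {w w' : ℤ → ℕ} {C : ℤ → ℕ → ℕ} {p s : ℕ → ℤ}

/-- The unloaded letter was in the carrier beforehand, so even when it equals `w m` a copy remains.
-/
theorem loaded (h : IsCarrierPass L S w w' C) (m : ℤ) : 0 < C (m + 1) (w m) := by
  have h1 := h.step m (w m) (h.mem m).1 (h.mem m).2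
  rw [if_pos rfl] at h1
  split_ifs at h1 with h2
  · have h3 := h.present m
    rw [h2] at h3
    omega
  · omega

/-- The letter just loaded is larger than `w m` and available. -/
theorem bump_of_descent (h : IsCarrierPass L S w w' C) {m : ℤ} (hm : w m < w (m - 1)) :
    w m < w' m := by
  by_contra h1
  have h2 := h.loaded (m - 1)
  rw [sub_add_cancel, h.pop_above m (by omega) _ hm (h.mem _).2] at h2
  exact lt_irrefl _ h2

/-- At a pop the carrier holds nothing above `w m`, and loading `w m` does not change that. -/
theorem pop_succ (h : IsCarrierPass L S w w' C) {m : ℤ} (hm : w' m ≤ w m)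
    (hd : w m ≤ w (m + 1)) : w' (m + 1) ≤ w (m + 1) := by
  by_contra h1
  have h2 := h.present (m + 1)
  have h3 := h.step m (w' (m + 1)) (h.mem' _).1 (h.mem' _).2
  rw [h.pop_above m hm _ (by omega) (h.mem' _).2, if_neg (by omega : w m ≠ w' (m + 1))] at h3
  omega

/-- A pop at `m - 1` removes the smallest letter, so `w'` cannot descend next. Two bumps under an
ascent of `w` cannot descend either, because no carrier letter lies strictly between `w (m - 1)` and
`w' (m - 1)`. In the remaining cases `w (m - 1)` is available at `m` and forces `w' m ≤ w (m - 1)`.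
-/
theorem descent_iff (h : IsCarrierPass L S w w' C) (m : ℤ) :
    w' m < w' (m - 1) ↔ w (m - 1) < w' (m - 1) ∧ (w' m ≤ w m ∨ w m < w (m - 1)) := by
  have hp := h.present m
  have hl := h.loaded (m - 1)
  have hs := h.step (m - 1) (w' m) (h.mem' _).1 (h.mem' _).2
  rw [sub_add_cancel] at hl hs
  constructor
  · intro hlt
    have h1 : w (m - 1) < w' (m - 1) := by
      by_contra h2
      rw [h.pop_below (m - 1) (by omega) _ (h.mem' _).1 hlt,
        if_neg (by omega : w (m - 1) ≠ w' m)] at hs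
      omega
    refine ⟨h1, ?_⟩
    by_contra h2
    push Not at h2
    rw [h.bump (m - 1) h1 (w' m) (by omega) hlt, if_neg (by omega : w (m - 1) ≠ w' m)] at hs
    omega
  · rintro ⟨h1, h2⟩
    refine lt_of_le_of_lt ?_ h1
    by_contra h3
    rcases le_or_gt (w' m) (w m) with h4 | h4
    · have := h.pop_below m h4 (w (m - 1)) (h.mem _).1 (by omega)
      omega
    · have := h.bump m h4 (w (m - 1)) (by omega) (by omega)
      omega

theorem exists_phase (h : IsCarrierPass L S w w' C) (hp : IsRunPartition L N w p) {n : ℕ}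
    (hn : n < N) : ∃ s, p n < s ∧ s ≤ p (n + 1) ∧ (n + 1 = N → s < p N) ∧
      (∀ m, p n ≤ m → m < s → w m < w' m) ∧ ∀ m, s ≤ m → m < p (n + 1) → w' m ≤ w m := by
  have key : ∀ y, p n + 1 ≤ y → y ≤ p (n + 1) → ∃ s, p n < s ∧ s ≤ y ∧
      (∀ m, p n ≤ m → m < s → w m < w' m) ∧ ∀ m, s ≤ m → m < y → w' m ≤ w m := by
    intro y hy
    induction y, hy using Int.leInduction with
    | base =>
      intro _
      refine ⟨p n + 1, by omega, le_rfl, fun m h1 h2 => ?_, fun m h1 h2 => by omega⟩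
      rw [show m = p n by omega]
      exact h.bump_of_descent ((hp.descent_iff _).2 ⟨n, hn, rfl⟩)
    | succ y hy ih =>
      intro hy'
      obtain ⟨s, h1, h2, h3, h4⟩ := ih (by omega)
      rcases h2.eq_or_lt with rfl | h5
      · rcases lt_or_ge (w s) (w' s) with h6 | h6
        · refine ⟨s + 1, by omega, le_rfl, fun m h7 h8 => ?_, fun m h7 h8 => by omega⟩
          rcases lt_or_ge m s with h9 | h9
          · exact h3 m h7 h9
          · rwa [show m = s by omega]
        · refine ⟨s, h1, by omega, h3, fun m h7 h8 => ?_⟩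
          rwa [show m = s by omega]
      · refine ⟨s, h1, by omega, h3, fun m h7 h8 => ?_⟩
        rcases lt_or_ge m y with h9 | h9
        · exact h4 m h7 h9
        · have h10 : m = y - 1 + 1 := by omega
          rw [h10]
          exact h.pop_succ (h4 (y - 1) (by omega) (by omega))
            (hp.le_of_mem_run hn (by omega) (by omega) (by omega))
  have hlt := hp.lt_succ n hn
  obtain ⟨s, h1, h2, h3, h4⟩ := key (p (n + 1)) (by omega) le_rfl
  -- The box before `p N` holds the largest letter, which cannot be bumped, so the last bump phase
  -- stops before it.
  refine ⟨s, h1, h2, fun h5 => ?_, h3, h4⟩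
  by_contra h6
  subst h5
  have h7 := h3 (p (n + 1) - 1) (by omega) (by omega)
  rw [hp.top_right _ (by omega)] at h7
  exact absurd (h.mem' (p (n + 1) - 1)).2 (by omega)

theorem exists_isPhaseCut (h : IsCarrierPass L S w w' C) (hp : IsRunPartition L N w p) :
    ∃ s, IsPhaseCut N w w' p s := by
  have : ∀ n, ∃ s, (n < N → p n < s ∧ s ≤ p (n + 1) ∧ (n + 1 = N → s < p N) ∧
      (∀ m, p n ≤ m → m < s → w m < w' m) ∧ ∀ m, s ≤ m → m < p (n + 1) → w' m ≤ w m) ∧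
      (n = N → s = p N) := by
    intro n
    rcases Nat.lt_or_ge n N with hn | hn
    · obtain ⟨s, hs⟩ := h.exists_phase hp hn
      exact ⟨s, fun _ => hs, fun h1 => by omega⟩
    · exact ⟨p N, fun h1 => by omega, fun _ => rfl⟩
  choose s hs using this
  exact ⟨s, fun n hn => ((hs n).1 hn).1, fun n hn => ((hs n).1 hn).2.1, (hs N).2 rfl,
    fun n hn => ((hs n).1 (by omega)).2.2.1 hn, fun n hn => ((hs n).1 hn).2.2.2.1,
    fun n hn => ((hs n).1 hn).2.2.2.2⟩

/-- The passage of the carrier preserves the number of runs. -/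
theorem isRunPartition (h : IsCarrierPass L S w w' C) (hp : IsRunPartition L N w p)
    (hs : IsPhaseCut N w w' p s) (hr : ∀ m, p N ≤ m + 1 → w' m = L)
    (hl : ∃ m₀, ∀ m, m ≤ m₀ → w' m = L) : IsRunPartition L N w' s := by
  refine ⟨fun m => (h.mem' m).2, fun n hn => ?_, fun m => ?_, fun m hm => ?_, hl⟩
  · rcases Nat.lt_or_ge (n + 1) N with h1 | h1
    · exact (hs.le n hn).trans_lt (hs.lt (n + 1) h1)
    · have h2 : n + 1 = N := by omega
      rw [h2, hs.last]
      exact hs.lt_last n h2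
  · rw [h.descent_iff]
    constructor
    · rintro ⟨h1, h2⟩
      have h3 : w (m - 1) ≠ L := by
        have := (h.mem' (m - 1)).2
        omega
      obtain ⟨n, hn, h4, h5⟩ := exists_run (N := N) (p := p) (x := m - 1)
        (by by_contra h4; exact h3 (hp.eq_top_of_lt (by omega)))
        (by by_contra h4; exact h3 (hp.top_right _ (by omega)))
      refine ⟨n, hn, ?_⟩
      have h6 : m - 1 < s n := by
        by_contra h6
        have := hs.pop n hn (m - 1) (by omega) h5
        omega
      by_contra h7
      have h8 := hs.bump n hn m (by omega) (by omega)
      have := hs.le n hn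
      exact hp.not_descent hn (m := m) (by omega) (by omega) (by omega)
    · rintro ⟨n, hn, rfl⟩
      have h1 := hs.lt n hn
      have h2 := hs.le n hn
      refine ⟨hs.bump n hn _ (by omega) (by omega), ?_⟩
      rcases h2.eq_or_lt with h3 | h3
      · right
        rcases Nat.lt_or_ge (n + 1) N with h4 | h4
        · rw [h3]
          exact (hp.descent_iff _).2 ⟨n + 1, h4, rfl⟩
        · have h5 : n + 1 = N := by omega
          have := hs.lt_last n h5
          rw [h3, h5] at this
          exact absurd this (lt_irrefl _)
      · exact Or.inl (hs.pop n hn _ le_rfl h3)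
  · rw [hs.last] at hm
    exact hr m hm

theorem conservation (h : IsCarrierPass L S w w' C) {k : ℕ} (hk : 1 ≤ k) (hk' : k ≤ L) {x y : ℤ}
    (hxy : x ≤ y) :
    (C y k : ℤ) + letterCount w' k x y = C x k + letterCount w k x y := by
  induction y, hxy using Int.leInduction with
  | base => simp [letterCount_self]
  | succ y hxy ih =>
    have h1 := h.step y k hk hk'
    rw [letterCount_succ _ _ hxy, letterCount_succ _ _ hxy]
    split_ifs at h1 ⊢ <;> omega

/-- When a bump unloads `k`, the current letter is below `k`, so by monotonicity no `k` has been
loaded yet. Every `k` loaded in this phase is therefore still held at its end. -/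
theorem letterCount_le_carrier (h : IsCarrierPass L S w w' C) {k : ℕ} (hk : 1 ≤ k) (hk' : k ≤ L)
    {x y : ℤ} (hxy : x ≤ y) (hb : ∀ m, x ≤ m → m < y → w m < w' m)
    (hm : ∀ m m', x ≤ m → m ≤ m' → m' < y → w m ≤ w m') :
    letterCount w k x y ≤ C y k := by
  induction y, hxy using Int.leInduction with
  | base => simp [letterCount_self]
  | succ y hxy ih =>
    have h1 := h.step y k hk hk'
    have h2 := hb y hxy (by omega)
    have h3 := ih (fun m h3 h4 => hb m h3 (by omega)) (fun m m' h3 h4 h5 => hm m m' h3 h4 (by omega))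
    by_cases h4 : w' y = k
    · rw [letterCount_eq_zero fun m h5 h6 => ?_]
      · omega
      · have := hm m y h5 (by omega) (by omega)
        omega
    · rw [letterCount_succ _ _ hxy]
      rw [if_neg h4] at h1
      split_ifs at h1 ⊢ <;> omega

/-- The number of letters `i + 1` unloaded from the cut `x` of one run to the cut `y` of the next
one, where `a` is the position at which the next run begins and `b` the one at which it ends. -/
theorem letterCount_eq_min (h : IsCarrierPass L S w w' C) {i : ℕ} (hi : i + 1 ≤ L) {x a y b : ℤ}
    (hxa : x ≤ a) (hay : a ≤ y) (hyb : y ≤ b) (h₁ : ∀ m, x ≤ m → m < a → w' m ≤ w m)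
    (h₂ : ∀ m, a ≤ m → m < y → w m < w' m) (h₃ : ∀ m, y ≤ m → m < b → w' m ≤ w m)
    (m₁ : ∀ m m', x ≤ m → m ≤ m' → m' < a → w m ≤ w m')
    (m₂ : ∀ m m', a ≤ m → m ≤ m' → m' < b → w m ≤ w m') :
    letterCount w' (i + 1) x y = min (C x (i + 1) + letterCount w (i + 1) x a)
      (a - x + ∑ j ∈ Finset.Icc 1 i, letterCount w j a b -
        ∑ j ∈ Finset.Icc 1 i, letterCount w' j x y) := by
  have hcons := h.conservation (k := i + 1) (by omega) hi (hxa.trans hay)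
  rw [← letterCount_add w (i + 1) hxa hay] at hcons
  have hle := h.letterCount_le_carrier (k := i + 1) (by omega) hi hay h₂
    fun m m' h1 h2 h3 => m₂ m m' h1 h2 (by omega)
  have hsum := Finset.sum_Icc_succ_top (show 1 ≤ i + 1 by omega)
    fun j => letterCount w' j x y
  rw [sum_letterCount w' (fun m => (h.mem' m).1) (i + 1),
    ← sum_Ico_add_sum_Ico_int _ hxa hay] at hsum
  rw [sum_letterCount w (fun m => (h.mem m).1), ← sum_Ico_add_sum_Ico_int _ hay hyb]
  have hone : ∑ m ∈ Finset.Ico x a, (1 : ℤ) = a - x := by simp [hxa]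
  -- Counting the letters `≤ i + 1` in `w'` on the three stretches shows that the second argument of
  -- the minimum is always an upper bound; `hle` does the same for the first.
  have hup₁ : ∑ m ∈ Finset.Ico x a, (if w' m ≤ i + 1 then (1 : ℤ) else 0) ≤ a - x := by
    rw [← hone]
    exact Finset.sum_le_sum fun m _ => by split_ifs <;> simp
  have hup₂ : ∑ m ∈ Finset.Ico a y, (if w' m ≤ i + 1 then (1 : ℤ) else 0) ≤
      ∑ m ∈ Finset.Ico a y, if w m ≤ i then 1 else 0 := by
    refine Finset.sum_le_sum fun m hm => ?_
    rw [Finset.mem_Ico] at hm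
    have := h₂ m hm.1 hm.2
    split_ifs <;> omega
  have hup₃ : 0 ≤ ∑ m ∈ Finset.Ico y b, (if w m ≤ i then (1 : ℤ) else 0) :=
    Finset.sum_nonneg fun m _ => by split_ifs <;> simp
  rcases hle.eq_or_lt with heq | hlt
  · omega
  -- If the first bound is strict, a letter `i + 1` stays in the carrier throughout the bump phase,
  -- and this makes each of the three estimates an equality.
  · have hpos : ∀ m, a ≤ m → m ≤ y → 0 < C m (i + 1) := by
      intro m h1 h2
      have h3 := h.conservation (k := i + 1) (by omega) hi h2
      rw [← letterCount_add w (i + 1) h1 h2] at hlt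
      have := letterCount_nonneg w (i + 1) a m
      have := letterCount_nonneg w' (i + 1) m y
      omega
    have heq₁ : ∑ m ∈ Finset.Ico x a, (if w' m ≤ i + 1 then (1 : ℤ) else 0) = a - x := by
      rw [← hone]
      refine Finset.sum_congr rfl fun m hm => if_pos ?_
      rw [Finset.mem_Ico] at hm
      by_contra h1
      have h2 := h₁ m hm.1 hm.2
      have h3 := h.pop_below m h2 (i + 1) (by omega) (by omega)
      have h4 := h.conservation (k := i + 1) (by omega) hi hm.2.le
      rw [letterCount_eq_zero (w := w) fun m' h5 h6 => ?_] at h4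
      · have := letterCount_nonneg w' (i + 1) m a
        have := hpos a le_rfl hay
        omega
      · have := m₁ m m' hm.1 h5 h6
        omega
    have heq₂ : ∑ m ∈ Finset.Ico a y, (if w' m ≤ i + 1 then (1 : ℤ) else 0) =
        ∑ m ∈ Finset.Ico a y, if w m ≤ i then 1 else 0 := by
      refine Finset.sum_congr rfl fun m hm => ?_
      rw [Finset.mem_Ico] at hm
      have h1 := h₂ m hm.1 hm.2
      have h2 : w m ≤ i → w' m ≤ i + 1 := by
        intro h3
        by_contra h4
        have := h.bump m h1 (i + 1) (by omega) (by omega)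
        have := hpos m hm.1 hm.2.le
        omega
      split_ifs <;> omega
    have heq₃ : ∑ m ∈ Finset.Ico y b, (if w m ≤ i then (1 : ℤ) else 0) = 0 := by
      refine Finset.sum_eq_zero fun m hm => if_neg ?_
      rw [Finset.mem_Ico] at hm
      have h1 := h₃ y le_rfl (by omega)
      have h2 := m₂ y m hay hm.1 hm.2
      intro h3
      have := h.pop_above y h1 (i + 1) (by omega) hi
      have := hpos y hay le_rfl
      omega
    omega

/-- The load of the carrier at the cut `x` of a run that ends at `a`, where `c` is the number of
empty places in the run. -/
theorem excess_eq {M : ℕ} (h : IsCarrierPass (M + 1) S w w' C) {z x a : ℤ} (hzx : z ≤ x)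
    (hxa : x ≤ a) (h₁ : ∀ m, z ≤ m → m < x → w m < w' m) (h₂ : ∀ m, x ≤ m → m < a → w' m ≤ w m)
    (m₁ : ∀ m m', x ≤ m → m ≤ m' → m' < a → w m ≤ w m') :
    a - x = letterCount w (M + 1) z a +
      max 0 (∑ j ∈ Finset.Icc 1 M, ((C x j : ℤ) + letterCount w j x a) - S) ∧
    C x (M + 1) + letterCount w (M + 1) x a = letterCount w (M + 1) z a +
      max 0 (S - ∑ j ∈ Finset.Icc 1 M, ((C x j : ℤ) + letterCount w j x a)) := by
  -- The largest letter cannot be bumped, so all empty boxes of the run lie after the cut.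
  have hz : letterCount w (M + 1) z x = 0 := letterCount_eq_zero fun m h3 h4 => by
    have := h₁ m h3 h4
    have := (h.mem' m).2
    omega
  have hE : letterCount w (M + 1) x a = letterCount w (M + 1) z a := by
    rw [← letterCount_add w (M + 1) hzx hxa, hz, zero_add]
  have hC := h.total x
  have hlen := sum_letterCount_eq_length (fun m => (h.mem m).1) hxa (fun m => (h.mem m).2)
  rw [Finset.sum_Icc_succ_top (by omega)] at hC hlen
  have hC' : ∑ j ∈ Finset.Icc 1 M, (C x j : ℤ) + C x (M + 1) = S := by exact_mod_cast hC
  rw [Finset.sum_add_distrib, ← hE]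
  -- A pop at `x` with an empty place in the carrier forces `w x = M + 1`. So either the carrier is
  -- full at the cut and the excess is nonnegative, or the rest of the run is empty and the excess
  -- is nonpositive.
  have hcase : C x (M + 1) = 0 ∨ letterCount w (M + 1) x a = a - x := by
    rcases hxa.eq_or_lt with rfl | hlt
    · right
      rw [letterCount_self, sub_self]
    · rcases Nat.eq_zero_or_pos (C x (M + 1)) with h3 | h3
      · exact Or.inl h3
      · right
        refine letterCount_eq_length hxa fun m h4 h5 => ?_
        have h6 := h.pop_above x (h₂ x le_rfl hlt) (M + 1)
        have h7 := m₁ x m le_rfl h4 h5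
        have h8 := (h.mem m).2
        by_contra h9
        have := h6 (by omega) le_rfl
        omega
  have hnn : 0 ≤ ∑ j ∈ Finset.Icc 1 M, letterCount w j x a :=
    Finset.sum_nonneg fun j _ => letterCount_nonneg w j x a
  constructor <;> omega

/-- The evolution of the contents of the runs under the passage of a carrier. -/
theorem exists_evolution {M : ℕ} (h : IsCarrierPass (M + 1) S w w' C)
    (hp : IsRunPartition (M + 1) N w p) (hr : ∀ m, p N ≤ m + 1 → w' m = M + 1)
    (hl : ∃ m₀, ∀ m, m ≤ m₀ → w' m = M + 1) (hCr : ∀ k, 1 ≤ k → k ≤ M → C (p N) k = 0)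
    (hCl : ∃ m₀, ∀ m, m ≤ m₀ → ∀ k, 1 ≤ k → k ≤ M → C m k = 0) :
    ∃ (s : ℕ → ℤ) (D : ℕ → ℕ → ℤ), IsRunPartition (M + 1) N w' s ∧ IsBlockEvolution M N S
      (fun k n => letterCount w k (p n) (p (n + 1)))
      (fun n => letterCount w (M + 1) (p n) (p (n + 1)))
      (fun k n => letterCount w' k (s n) (s (n + 1)))
      (fun n => letterCount w' (M + 1) (s n) (s (n + 1))) D := by
  obtain ⟨s, hs⟩ := h.exists_isPhaseCut hp
  have hp' := h.isRunPartition hp hs hr hl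
  have hmin : ∀ i n, i ≤ M → n + 1 < N → letterCount w' (i + 1) (s n) (s (n + 1)) =
      min (C (s n) (i + 1) + letterCount w (i + 1) (s n) (p (n + 1)))
      (p (n + 1) - s n + ∑ j ∈ Finset.Icc 1 i, letterCount w j (p (n + 1)) (p (n + 1 + 1)) -
        ∑ j ∈ Finset.Icc 1 i, letterCount w' j (s n) (s (n + 1))) := by
    intro i n hi hn
    have := hs.lt n (by omega)
    exact h.letterCount_eq_min (by omega) (hs.le n (by omega)) (hs.lt (n + 1) hn).le
      (hs.le (n + 1) hn) (hs.pop n (by omega)) (hs.bump (n + 1) hn) (hs.pop (n + 1) hn)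
      (fun m m' h1 h2 h3 => hp.le_of_mem_run (by omega) (by omega) h2 h3)
      (fun m m' h1 h2 h3 => hp.le_of_mem_run hn h1 h2 h3)
  have hex : ∀ n, n < N → _ := fun n hn =>
    h.excess_eq (hs.lt n hn).le (hs.le n hn) (hs.bump n hn) (hs.pop n hn)
      (fun m m' h1 h2 h3 => hp.le_of_mem_run hn ((hs.lt n hn).le.trans h1) h2 h3)
  -- The load of a run is what the carrier holds at the cut plus what the rest of the run still
  -- offers.
  refine ⟨s, fun k n => C (s n) k + letterCount w k (s n) (p (n + 1)), hp',
    fun k h1 h2 h3 => ?_, fun k n h1 h2 h3 => ?_, fun k n h1 h2 h3 => ?_, fun i n hi hn => ?_,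
    fun n hn => ?_⟩
  · obtain ⟨m₀, hm₀⟩ := hCl
    have h4 := hs.lt 0 h3
    have h5 := h.conservation (k := k) (x := min m₀ (p 0)) (y := s 0) h1 (by omega) (by omega)
    rw [hm₀ _ (min_le_left _ _) k h1 h2, letterCount_eq_zero (w := w') fun m _ h6 => ?_,
      ← letterCount_add w k (min_le_right m₀ (p 0)) h4.le,
      letterCount_eq_zero (y := p 0) fun m _ h6 => ?_] at h5
    · rw [← letterCount_add w k h4.le (hs.le 0 h3)]
      push_cast at h5
      omega
    · rw [hp.eq_top_of_lt h6]
      omega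
    · rw [hp'.eq_top_of_lt h6]
      omega
  · have h4 := h.conservation (k := k) h1 (by omega) (hp'.lt_succ n (by omega)).le
    have h5 := hs.le n (by omega)
    have h6 := hs.lt (n + 1) h3
    have h7 := hs.le (n + 1) h3
    rw [← letterCount_add w k h5 h6.le] at h4
    rw [← letterCount_add w k h6.le h7]
    omega
  · have h4 := h.conservation (k := k) h1 (by omega) (hp'.lt_succ n (by omega)).le
    subst h3
    rw [hs.last] at h4 ⊢
    rw [hCr k h1 h2] at h4
    push_cast at h4
    omega
  · rw [hmin i n (by omega) hn, (hex n (by omega)).1]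
  -- Gaps are the case `i = M` of the same count, for the letter `M + 1`.
  · rw [hmin M n le_rfl hn, (hex n (by omega)).2, (hex n (by omega)).1]

end IsCarrierPass

/-! ### Blocks as the nonempty parts of runs -/

theorem sum_Icc_eq_letterCount {L k : ℕ} {w : ℤ → ℕ} {x y b : ℤ} (hb : x ≤ b) (hb' : b < y)
    (h : ∀ m, b < m → m < y → w m = L) (hk : k < L) :
    ∑ m ∈ Finset.Icc x b, (if w m = k then (1 : ℤ) else 0) = letterCount w k x y := by
  rw [← letterCount_add w k (by omega : x ≤ b + 1) (by omega : b + 1 ≤ y),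
    letterCount_eq_zero (x := b + 1) fun m h3 h4 => ?_, add_zero]
  · exact Finset.sum_congr (Finset.ext fun m => by
      simp only [Finset.mem_Icc, Finset.mem_Ico]; omega) fun _ _ => rfl
  · rw [h m (by omega) h4]
    omega

theorem sum_Ioo_eq_letterCount {L : ℕ} {w : ℤ → ℕ} {x y b : ℤ} (hb : x ≤ b) (hb' : b < y)
    (h : ∀ m, x ≤ m → m ≤ b → w m < L) :
    ∑ m ∈ Finset.Ioo b y, (if w m = L then (1 : ℤ) else 0) = letterCount w L x y := by
  rw [← letterCount_add w L (by omega : x ≤ b + 1) (by omega : b + 1 ≤ y),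
    letterCount_eq_zero (y := b + 1) fun m h3 h4 => (h m h3 (by omega)).ne, zero_add]
  exact Finset.sum_congr (Finset.ext fun m => by
    simp only [Finset.mem_Ioo, Finset.mem_Ico]; omega) fun _ _ => rfl

namespace IsRunPartition

variable {L N : ℕ} {w : ℤ → ℕ} {p : ℕ → ℤ}

/-- The nonempty boxes of a run precede the empty ones. -/
theorem exists_block_end (h : IsRunPartition L N w p) {n : ℕ} (hn : n < N) :
    ∃ b, p n ≤ b ∧ b < p (n + 1) ∧ (∀ m, p n ≤ m → m ≤ b → w m < L) ∧
      ∀ m, b < m → m < p (n + 1) → w m = L := by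
  have key : ∀ y, p n + 1 ≤ y → y ≤ p (n + 1) → ∃ b, p n ≤ b ∧ b < y ∧
      (∀ m, p n ≤ m → m ≤ b → w m < L) ∧ ∀ m, b < m → m < y → w m = L := by
    intro y hy
    induction y, hy using Int.leInduction with
    | base =>
      intro _
      refine ⟨p n, le_rfl, by omega, fun m h1 h2 => ?_, fun m h1 h2 => by omega⟩
      rw [show m = p n by omega]
      exact h.lt_top hn
    | succ y hy ih =>
      intro hy'
      obtain ⟨b, h1, h2, h3, h4⟩ := ih (by omega)
      have h5 := h.le_top y
      rcases h5.lt_or_eq with h6 | h6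
      · refine ⟨y, by omega, by omega, fun m h7 h8 => ?_, fun m h7 h8 => by omega⟩
        exact (h.le_of_mem_run hn h7 h8 (by omega)).trans_lt h6
      · refine ⟨b, h1, by omega, h3, fun m h7 h8 => ?_⟩
        rcases lt_or_ge m y with h9 | h9
        · exact h4 m h7 h9
        · rwa [show m = y by omega]
  exact key _ (by have := h.lt_succ n hn; omega) le_rfl

variable {c : ℤ → ℕ} {b : ℕ → ℤ}

theorem isBallBlock (h : IsRunPartition L N w p) (hw : ∀ m, 1 ≤ w m)
    (hc : ∀ m, c m = if w m = L then 0 else w m) {n : ℕ} (hn : n < N) {b : ℤ} (hb : p n ≤ b)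
    (hb' : b < p (n + 1)) (h₁ : ∀ m, p n ≤ m → m ≤ b → w m < L)
    (h₂ : ∀ m, b < m → m < p (n + 1) → w m = L) : IsBallBlock c (p n) b := by
  have hcw : ∀ m, p n ≤ m → m ≤ b → c m = w m := fun m h3 h4 => by
    rw [hc, if_neg (h₁ m h3 h4).ne]
  refine ⟨hb, fun m h3 h4 => ?_, fun m h3 h4 => ?_, ?_, ?_⟩
  · rw [hcw m h3 h4]
    have := hw m
    omega
  · rw [hcw m h3 h4.le, hcw (m + 1) (by omega) (by omega)]
    exact h.le_of_mem_run hn h3 (by omega) (by omega)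
  · have h3 := (h.descent_iff (p n)).2 ⟨n, hn, rfl⟩
    rw [hcw (p n) le_rfl hb, hc (p n - 1)]
    split_ifs
    · exact Or.inl rfl
    · exact Or.inr h3
  · rcases lt_or_ge (b + 1) (p (n + 1)) with h3 | h3
    · left
      rw [hc, if_pos (h₂ _ (by omega) h3)]
    · have h4 : b + 1 = p (n + 1) := by omega
      rcases Nat.lt_or_ge (n + 1) N with h5 | h5
      · right
        have h6 := (h.descent_iff (p (n + 1))).2 ⟨n + 1, h5, rfl⟩
        rw [← h4, add_sub_cancel_right] at h6
        rw [hcw b hb le_rfl, hc, if_neg (by have := h.le_top b; omega)]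
        exact h6
      · have h6 : n + 1 = N := by omega
        rw [h6] at h4
        have h7 := h₁ b hb le_rfl
        rw [h.top_right b (by omega)] at h7
        exact absurd h7 (lt_irrefl _)

/-- The blocks of balls are the nonempty parts of the runs. -/
theorem isBlockEnumeration (h : IsRunPartition L N w p) (hw : ∀ m, 1 ≤ w m)
    (hc : ∀ m, c m = if w m = L then 0 else w m)
    (hb : ∀ n, n < N → p n ≤ b n ∧ b n < p (n + 1) ∧ (∀ m, p n ≤ m → m ≤ b n → w m < L) ∧
      ∀ m, b n < m → m < p (n + 1) → w m = L) : IsBlockEnumeration c N p b := by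
  have hblock : ∀ n, n < N → IsBallBlock c (p n) (b n) := fun n hn => by
    obtain ⟨h1, h2, h3, h4⟩ := hb n hn
    exact h.isBallBlock hw hc hn h1 h2 h3 h4
  refine ⟨hblock, fun n hn => (hb n (by omega)).2.1, fun x y hxy => ?_⟩
  have hx : w x < w (x - 1) := by
    have h1 := hxy.occupied x le_rfl hxy.le
    have h2 := hxy.left_maximal
    have h3 := h.le_top x
    have h4 := hw (x - 1)
    rw [hc] at h1
    rw [hc, hc] at h2
    split_ifs at h1 h2 <;> omega
  obtain ⟨n, hn, rfl⟩ := (h.descent_iff x).1 hx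
  refine ⟨n, hn, rfl, ?_⟩
  have hB := hblock n hn
  rcases lt_trichotomy (b n) y with h1 | h1 | h1
  · have h2 := hxy.occupied (b n + 1) (by have := hB.le; omega) (by omega)
    have h3 := hxy.ascending (b n) hB.le h1
    have h4 := hB.right_maximal
    omega
  · exact h1
  · have h2 := hB.occupied (y + 1) (by have := hxy.le; omega) (by omega)
    have h3 := hB.ascending y hxy.le h1
    have h4 := hxy.right_maximal
    omega

/-- Only the right ends `p N` and `p' N` may differ. Beyond either of them every letter is `L`,
which `k < L` does not count. -/
theorem letterCount_congr {N' : ℕ} {p' : ℕ → ℤ} (h : IsRunPartition L N w p)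
    (h' : IsRunPartition L N' w p') {n k : ℕ} (hn : n < N) (hk : k < L) :
    letterCount w k (p n) (p (n + 1)) = letterCount w k (p' n) (p' (n + 1)) := by
  obtain ⟨rfl, hpp⟩ := h.unique h'
  have key : ∀ q : ℕ → ℤ, IsRunPartition L N w q → ∀ z, q N ≤ z → n + 1 = N →
      letterCount w k (q n) z = letterCount w k (q n) (q (n + 1)) := by
    intro q hq z hz hnN
    have := hq.lt_succ n hn
    subst hnN
    rw [← letterCount_add w k this.le hz, letterCount_eq_zero (x := q (n + 1)), add_zero]
    intro m h1 _
    rw [hq.top_right m (by omega)]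
    omega
  rcases Nat.lt_or_ge (n + 1) N with h1 | h1
  · rw [hpp n hn, hpp (n + 1) h1]
  · have h2 : n + 1 = N := by omega
    rw [← key p h _ (le_max_left _ (p' N)) h2, ← key p' h' _ (le_max_right (p N) _) h2, hpp n hn]

end IsRunPartition

/-! ### From the block data to the lattice -/

theorem sum_range_one_add (f : ℤ → ℤ) (M : ℕ) :
    ∑ j ∈ Finset.range M, f (1 + j) = ∑ j ∈ Finset.Icc 1 M, f (j : ℕ) := by
  rw [← Finset.Ico_add_one_right_eq_Icc, Finset.sum_Ico_eq_sum_range, Nat.add_sub_cancel]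
  exact Finset.sum_congr rfl fun j _ => by push_cast; rfl

/-- Both sides obey the same recursion, in `n` and within each site in `k`. The blocks know only the
gap for `k = 1`; compatibility in the index, telescoped, turns `Ẽ (1 + i)` into the partial sums
that occur in the block formulas. -/
theorem IsBlockEvolution.eq_capacityEvolution {M N : ℕ} {S : ℤ} {q q' D₀ : ℕ → ℕ → ℤ}
    {e e' : ℕ → ℤ} {Q E D Q' E' d : ℤ → ℕ → ℤ} (hB : IsBlockEvolution M N S q e q' e' D₀)
    (hT : IsHungryToda M N Q E d) (hC : IsCapacityEvolution M N S Q E D Q' E')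
    (hq : ∀ k n : ℕ, 1 ≤ k → k ≤ M → n < N → Q k n = q k n)
    (he : ∀ n, n + 1 < N → E 1 n = e n) :
    (∀ k n : ℕ, 1 ≤ k → k ≤ M → n < N → Q' k n = q' k n) ∧
      ∀ n, n + 1 < N → E' 1 n = e' n := by
  have hW : ∀ n, (∀ k : ℕ, 1 ≤ k → k ≤ M → D k n = D₀ k n) →
      carrierExcess M S D 1 n = ∑ j ∈ Finset.Icc 1 M, D₀ j n - S := by
    intro n hD
    rw [carrierExcess, sum_range_one_add fun i => D i n]
    congr 1
    exact Finset.sum_congr rfl fun j hj => by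
      rw [Finset.mem_Icc] at hj
      exact hD j hj.1 hj.2
  have htel : ∀ n, n + 1 < N → ∀ i : ℕ, i ≤ M → (∀ k : ℕ, 1 ≤ k → k ≤ i → Q' k n = q' k n) →
      E (1 + i) n + max 0 (carrierExcess M S D (1 + i) n) =
        e n + max 0 (carrierExcess M S D 1 n) + ∑ j ∈ Finset.Icc 1 i, q j (n + 1) -
          ∑ j ∈ Finset.Icc 1 i, q' j n := by
    intro n hn i hi hq'
    have h1 : ∑ j ∈ Finset.Icc 1 i, Q' j n = ∑ j ∈ Finset.Icc 1 i, q' j n :=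
      Finset.sum_congr rfl fun j hj => by
        rw [Finset.mem_Icc] at hj
        exact hq' j hj.1 hj.2
    have h2 : ∑ j ∈ Finset.Icc 1 i, Q j (n + 1) = ∑ j ∈ Finset.Icc 1 i, q j (n + 1) :=
      Finset.sum_congr rfl fun j hj => by
        rw [Finset.mem_Icc] at hj
        exact hq j (n + 1) hj.1 (by omega) hn
    rw [IsCapacityEvolution.telescope (hC.invariant hT n hn).2,
      sum_range_one_add fun k => Q' k n - Q k (n + 1), he n hn, Finset.sum_sub_distrib, h1, h2]
    ring
  have hstep : ∀ n, n < N → (∀ k : ℕ, 1 ≤ k → k ≤ M → D k n = D₀ k n) →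
      ∀ k : ℕ, 1 ≤ k → k ≤ M → Q' k n = q' k n := by
    intro n hn hD k
    induction k using Nat.strong_induction_on with
    | _ k ih =>
      intro hk hk'
      rcases Nat.lt_or_ge (n + 1) N with hn' | hn'
      · obtain ⟨i, rfl⟩ : ∃ i, k = i + 1 := ⟨k - 1, by omega⟩
        have h1 := htel n hn' i (by omega) fun j h1 h2 => ih j (by omega) h1 (by omega)
        rw [hC.drop, if_pos hn', hB.drop i n (by omega) hn', ← hW n hD, ← h1, hD _ hk hk',
          show ((i + 1 : ℕ) : ℤ) = 1 + i by push_cast; ring]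
      · rw [hC.drop, if_neg (by omega), hB.last k n hk hk' (by omega), hD k hk hk']
  have hD : ∀ n, n < N → ∀ k : ℕ, 1 ≤ k → k ≤ M → D k n = D₀ k n := by
    intro n
    induction n with
    | zero =>
      intro hn k hk hk'
      rw [hC.load_zero, hB.load_zero k hk hk' hn, hq k 0 hk hk' hn]
    | succ n ih =>
      intro hn k hk hk'
      have h1 := ih (by omega)
      rw [hC.load_succ, hB.load_succ k n hk hk' hn, h1 k hk hk', hq k (n + 1) hk hk' hn,
        hstep n (by omega) h1 k hk hk']
  refine ⟨fun k n hk hk' hn => hstep n hn (hD n hn) k hk hk', fun n hn => ?_⟩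
  have h1 := htel n hn M le_rfl fun j h1 h2 => hstep n (by omega) (hD n (by omega)) j h1 h2
  rw [hC.gap, if_pos hn, hB.gap n hn, add_comm (1 : ℤ) M, add_comm (M : ℤ) 1, h1,
    hW n (hD n (by omega)), he n hn, neg_sub]

/-- Orbits are compared as functions on all of `ℕ`, so the values past the last block must agree
too. -/
theorem IsCapacityEvolution.eq_zero_of_le {M N : ℕ} {S : ℤ} {Q E D Q' E' : ℤ → ℕ → ℤ}
    (h : IsCapacityEvolution M N S Q E D Q' E') {k : ℤ} (hk : ∀ n, N ≤ n → Q k n = 0) {n : ℕ}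
    (hn : N ≤ n) : Q' k n = 0 := by
  rw [h.drop, if_neg (by omega)]
  cases n with
  | zero => rw [h.load_zero, hk 0 hn]
  | succ n => rw [h.load_succ, h.drop, if_neg (by omega), hk (n + 1) hn]; ring

theorem IsBlockEvolution.congr {M N : ℕ} {S : ℤ} {q r q' r' D : ℕ → ℕ → ℤ} {e f e' f' : ℕ → ℤ}
    (h : IsBlockEvolution M N S q e q' e' D)
    (hq : ∀ k n, 1 ≤ k → k ≤ M → n < N → q k n = r k n) (he : ∀ n, n + 1 < N → e n = f n)
    (hq' : ∀ k n, 1 ≤ k → k ≤ M → n < N → q' k n = r' k n)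
    (he' : ∀ n, n + 1 < N → e' n = f' n) : IsBlockEvolution M N S r f r' f' D := by
  have hsum : ∀ i n, i ≤ M → n + 1 < N →
      ∑ j ∈ Finset.Icc 1 i, q j (n + 1) = ∑ j ∈ Finset.Icc 1 i, r j (n + 1) :=
    fun i n hi hn => Finset.sum_congr rfl fun j hj => by
      rw [Finset.mem_Icc] at hj
      exact hq j (n + 1) hj.1 (by omega) hn
  have hsum' : ∀ i n, i ≤ M → n < N →
      ∑ j ∈ Finset.Icc 1 i, q' j n = ∑ j ∈ Finset.Icc 1 i, r' j n :=
    fun i n hi hn => Finset.sum_congr rfl fun j hj => by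
      rw [Finset.mem_Icc] at hj
      exact hq' j n hj.1 (by omega) hn
  refine ⟨fun k h1 h2 h3 => ?_, fun k n h1 h2 h3 => ?_, fun k n h1 h2 h3 => ?_,
    fun i n h1 h2 => ?_, fun n h1 => ?_⟩
  · rw [h.load_zero k h1 h2 h3, hq k 0 h1 h2 h3]
  · rw [h.load_succ k n h1 h2 h3, hq' k n h1 h2 (by omega), hq k (n + 1) h1 h2 h3]
  · rw [← hq' k n h1 h2 (by omega), h.last k n h1 h2 h3]
  · rw [← hq' (i + 1) n (by omega) (by omega) (by omega), h.drop i n h1 h2, he n h2,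
      hsum i n h1.le h2, hsum' i n h1.le (by omega)]
  · rw [← he' n h1, h.gap n h1, he n h1, hsum M n le_rfl h1, hsum' M n le_rfl (by omega)]

/-- The contents of the blocks, extended by zero, as data for the autonomous lattice. -/
def blockData (m N : ℕ) (q : ℕ → ℕ → ℤ) (e : ℕ → ℤ) : (Fin (m + 1) → ℕ → ℤ) × (ℕ → ℤ) :=
  (fun j n => if n < N then q (j + 1) n else 0, fun n => if n + 1 < N then e n else 0)

/-- If the contents of the blocks evolve at every time under a carrier of capacity `S t`, then they
satisfy the nonautonomous ultradiscrete hungry Toda lattice. -/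
theorem exists_isNonautonomousUltradiscreteHungryToda {M N : ℕ} (hM : 1 ≤ M) (S : ℤ → ℕ)
    (q : ℤ → ℕ → ℕ → ℤ) (e : ℤ → ℕ → ℤ)
    (h : ∀ t, ∃ D, IsBlockEvolution M N (S t) (q t) (e t) (q (t + 1)) (e (t + 1)) D) :
    ∃ (Q D : ℤ → ℤ → ℕ → ℤ) (E Et F : ℤ → ℤ → ℕ → WithTop ℤ),
      (∀ (k : ℕ) (t : ℤ) (n : ℕ), 1 ≤ k → k ≤ M → n < N → Q k t n = q t k n) ∧
      (∀ (t : ℤ) (n : ℕ), n + 1 < N → E 1 t n = (e t n : WithTop ℤ)) ∧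
      IsNonautonomousUltradiscreteHungryToda M N S Q D E Et F := by
  obtain ⟨m, rfl⟩ : ∃ m, M = m + 1 := ⟨M - 1, by omega⟩
  let x := fun t => blockData m N (q t) (e t)
  -- The exponent is `k - 1` because the data `x t` form the window at `k = 1`.
  let Q := fun (t k : ℤ) => ((hungryTodaPerm m N ^ (k - 1)) (x t)).1 0
  let E := fun (t k : ℤ) => ((hungryTodaPerm m N ^ (k - 1)) (x t)).2
  have hT : ∀ t, ∃ d, IsHungryToda (m + 1) N (Q t) (E t) d :=
    fun t => ⟨_, isHungryToda_orbit m N (x t)⟩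
  have hQ1 : ∀ t (j : Fin (m + 1)), Q t (1 + (j : ℕ)) = (x t).1 j := by
    intro t j
    have := hungryTodaPerm_zpow_apply m N (x t) 0 j j.2
    rw [zpow_zero] at this
    simp only [Q]
    rw [show (1 : ℤ) + (j : ℕ) - 1 = 0 + (j : ℕ) by ring, this]
    rfl
  have hE1 : ∀ t, E t 1 = (x t).2 := fun t => by simp [E]
  have hQ : ∀ t (k n : ℕ), 1 ≤ k → k ≤ m + 1 → Q t k n = if n < N then q t k n else 0 := by
    intro t k n h1 h2
    have := hQ1 t ⟨k - 1, by omega⟩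
    simp only at this
    rw [show (1 : ℤ) + ((k - 1 : ℕ) : ℤ) = k by omega] at this
    rw [this]
    simp only [x, blockData, show k - 1 + 1 = k by omega]
  choose d hd using hT
  choose D Q' E' hC using fun t => exists_isCapacityEvolution (m + 1) N (S t) (Q t) (E t)
  -- By commutation the evolved family is also an orbit, and its window at `k = 1` is `x (t + 1)`;
  -- hence equality for all `k`.
  have hev : ∀ t, Q' t = Q (t + 1) ∧ E' t = E (t + 1) := by
    intro t
    obtain ⟨D₀, hB⟩ := h t
    obtain ⟨h1, h2⟩ := hB.eq_capacityEvolution (hd t) (hC t)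
      (fun k n h3 h4 h5 => by rw [hQ t k n h3 h4, if_pos h5])
      (fun n h3 => by simp only [hE1, x, blockData, if_pos h3])
    have hx : ((fun j : Fin (m + 1) => Q' t (1 + (j : ℕ))), E' t 1) = x (t + 1) := by
      refine Prod.ext (funext fun j => funext fun n => ?_) (funext fun n => ?_)
      · have hj : (1 : ℤ) + (j : ℕ) = ((j + 1 : ℕ) : ℤ) := by push_cast; ring
        simp only [x, blockData]
        rw [hj]
        split_ifs with h3
        · exact h1 (j + 1) n (by omega) (by omega) h3
        · refine (hC t).eq_zero_of_le (fun n' hn' => ?_) (by omega)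
          rw [hQ t (j + 1) n' (by omega) (by omega), if_neg (by omega)]
      · simp only [x, blockData]
        split_ifs with h3
        · exact h2 n h3
        · rw [(hC t).gap, if_neg h3, hE1]
          simp only [x, blockData, if_neg h3]
    have horb := ((hC t).isHungryToda (hd t)).eq_orbit
    rw [hx] at horb
    constructor
    · funext k
      have := congrFun (congrArg Prod.fst (horb k)) 0
      simpa using this
    · funext k
      exact congrArg Prod.snd (horb k)
  have hQ' : ∀ t, Q' t = Q (t + 1) := fun t => (hev t).1
  have hE' : ∀ t, E' t = E (t + 1) := fun t => (hev t).2
  -- `Ẽ` and `F` are given by the boundary formulas at every site, with the load `D` in place of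
  -- `Q`, and by `⊤` at the last one.
  refine ⟨fun k t n => Q t k n, fun k t n => D t k n,
    fun k t n => if n + 1 < N then (E t k n : WithTop ℤ) else ⊤,
    fun k t n => if n + 1 < N then
      ((E t k n + max 0 (carrierExcess (m + 1) (S t) (D t) k n) : ℤ) : WithTop ℤ) else ⊤,
    fun k t n => if n + 1 < N then
      ((E t k n + max 0 (-carrierExcess (m + 1) (S t) (D t) k n) : ℤ) : WithTop ℤ) else ⊤,
    fun k t n h1 h2 h3 => by dsimp only; rw [hQ t k n h1 h2, if_pos h3], fun t n h1 => ?_, ?_⟩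
  · dsimp only
    rw [if_pos h1, hE1]
    simp only [x, blockData, if_pos h1]
  have hE_succ : ∀ k t n, n + 1 < N → E (t + 1) k n =
      min (E t k n + max 0 (-carrierExcess (m + 1) (S t) (D t) k n))
        (E t (k + (m + 1 : ℕ)) n + max 0 (carrierExcess (m + 1) (S t) (D t) (k + (m + 1 : ℕ)) n)) :=
    fun k t n hn => by rw [← hE' t, (hC t).gap, if_pos hn]
  have hW0 : ∀ k t, carrierExcess (m + 1) (S t) (D t) k 0 =
      ∑ j ∈ Finset.range (m + 1), Q t (k + j) 0 - S t := fun k t => by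
    simp only [carrierExcess, (hC t).load_zero]
  constructor
  · intro k t n hn
    rw [← hQ' t, (hC t).drop]
    split_ifs
    · exact WithTop.coe_min _ _
    · exact (min_top_right _).symm
  · intro k t n hn
    split_ifs with h1
    · rw [hE_succ k t n h1]
      exact WithTop.coe_min _ _
    · exact (min_self _).symm
  · intro k t n hn
    rw [(hC t).load_succ, hQ']
  · intro k t n hn
    have h1 := (hC t).carrierExcess_succ_eq ((hC t).invariant (hd t) n hn).2 k
    have h2 := hE_succ k t n hn
    rw [if_pos hn, if_pos hn]
    split_ifs
    · norm_cast
      omega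
    · rfl
  · intro k t n hn
    have h1 := ((hC t).invariant (hd t) n hn).2 k
    rw [if_pos hn, if_pos hn, ← hQ' t]
    norm_cast
  · intro k t n hn
    have h1 := (hC t).carrierExcess_succ_eq ((hC t).invariant (hd t) n hn).2 k
    have h2 := hE_succ k t n hn
    rw [if_pos hn, if_pos hn]
    split_ifs
    · norm_cast
      push_cast at h1 h2 ⊢
      omega
    · rfl
  · intro k t
    exact (hC t).load_zero k
  · intro k t
    rw [hW0, neg_sub]
    split_ifs
    · norm_cast
    · rfl
  · intro k t
    rw [hW0]
    split_ifs
    · norm_cast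
    · rfl
  · intro k t n hn
    rw [if_neg (by omega), if_neg (by omega)]
    exact ⟨rfl, rfl⟩
  · intro k t n hn
    rw [if_pos hn, if_pos hn]
    exact ⟨WithTop.coe_ne_top, WithTop.coe_ne_top⟩

/-! ### The theorem for the box–ball system -/

namespace IsBoxBallSystem

variable {M : ℕ} {S : ℤ → ℕ} {U V : ZMod (M + 1) → ℤ → ℤ → ℕ}

theorem boxIndex_eq_ite {w : ℤ → ℤ → ℕ} (hw : ∀ t n, 1 ≤ w t n ∧ w t n ≤ M + 1 ∧
      (fun k => U k t n) = Pi.single (w t n : ZMod (M + 1)) 1) (t n : ℤ) :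
    boxIndex M U t n = if w t n = M + 1 then 0 else w t n := by
  have h1 : ∀ k ∈ Finset.Icc 1 M, k * U (k : ZMod (M + 1)) t n = if w t n = k then k else 0 := by
    intro k hk
    rw [Finset.mem_Icc] at hk
    rw [box_eq_ite hw t n hk.1 (by omega), mul_ite, mul_one, mul_zero]
  obtain ⟨h3, h4, -⟩ := hw t n
  rw [boxIndex, Finset.sum_congr rfl h1, Finset.sum_ite_eq]
  simp only [Finset.mem_Icc]
  split_ifs <;> omega

/-- Far away the boxes and the carrier hold empty places only. -/
theorem exists_bound (h : IsBoxBallSystem M S U V) {w : ℤ → ℤ → ℕ}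
    (hw : ∀ t n, 1 ≤ w t n ∧ w t n ≤ M + 1 ∧
      (fun k => U k t n) = Pi.single (w t n : ZMod (M + 1)) 1) (t : ℤ) :
    ∃ B, ∀ n, B ≤ |n| → w t n = M + 1 ∧
      ∀ k : ℕ, 1 ≤ k → k ≤ M → V (k : ZMod (M + 1)) t n = 0 := by
  obtain ⟨B, hB⟩ := h.boundary t
  refine ⟨B, fun n hn => ?_⟩
  obtain ⟨h1, -, h3⟩ := hB n hn
  constructor
  · have h4 := box_eq_ite hw t n (k := M + 1) (by omega) le_rfl
    rw [ZMod.natCast_self, h1] at h4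
    by_contra h5
    rw [if_neg h5] at h4
    exact one_ne_zero h4
  · intro k hk hk'
    refine (h3 _ fun h4 => ?_).2
    rw [ZMod.natCast_eq_zero_iff] at h4
    have := Nat.le_of_dvd hk h4
    omega

end IsBoxBallSystem

theorem mainTheorem7 (M : ℕ) (hM : 1 ≤ M) (S : ℤ → ℕ) (hS : ∀ t, 0 < S t)
    (U V : ZMod (M + 1) → ℤ → ℤ → ℕ) (hUV : IsBoxBallSystem M S U V) :
    ∃ (N : ℕ) (a b : ℤ → ℕ → ℤ),
      (∀ t, IsBlockEnumeration (boxIndex M U t) N (a t) (b t)) ∧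
      ∃ (Q D : ℤ → ℤ → ℕ → ℤ) (E Et F : ℤ → ℤ → ℕ → WithTop ℤ),
        (∀ (k : ℕ) (t : ℤ) (n : ℕ), 1 ≤ k → k ≤ M → n < N →
          Q k t n = ∑ m ∈ Finset.Icc (a t n) (b t n), (U (k : ZMod (M + 1)) t m : ℤ)) ∧
        (∀ (t : ℤ) (n : ℕ), n + 1 < N →
          E 1 t n =
            ((∑ m ∈ Finset.Ioo (b t n) (a t (n + 1)), (U 0 t m : ℤ) : ℤ) : WithTop ℤ)) ∧
        IsNonautonomousUltradiscreteHungryToda M N S Q D E Et F := by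
  obtain ⟨w, hw⟩ := hUV.exists_letter
  have hpass := hUV.isCarrierPass hS hw
  choose B hB using hUV.exists_bound hw
  -- The bound covers times `t` and `t + 1`: the runs of both words are closed off at the same point
  -- `p t N`, where the carrier must hold no balls.
  have hpart : ∀ t, ∃ N p, IsRunPartition (M + 1) N (w t) p ∧
      p N = |max (B t) (B (t + 1))| + 1 := fun t =>
    exists_isRunPartition (fun m => (hw t m).2.1) fun m hm =>
      (hB t m (le_of_max_le_left hm)).1
  choose N p hp hpN using hpart
  have hstep : ∀ t, ∃ s D, IsRunPartition (M + 1) (N t) (w (t + 1)) s ∧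
      IsBlockEvolution M (N t) (S t)
        (fun k n => letterCount (w t) k (p t n) (p t (n + 1)))
        (fun n => letterCount (w t) (M + 1) (p t n) (p t (n + 1)))
        (fun k n => letterCount (w (t + 1)) k (s n) (s (n + 1)))
        (fun n => letterCount (w (t + 1)) (M + 1) (s n) (s (n + 1))) D := by
    intro t
    refine (hpass t).exists_evolution (hp t) (fun m hm => ?_) ?_ (fun k h1 h2 => ?_) ?_
    · rw [hpN] at hm
      exact (hB (t + 1) m ((le_max_right (B t) _).trans ((le_abs_self _).trans
        ((by omega : |max (B t) (B (t + 1))| ≤ m).trans (le_abs_self m))))).1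
    · exact ⟨-|B (t + 1)|, fun m hm => (hB (t + 1) m (by
        have := le_abs_self (B (t + 1))
        have := neg_le_abs m
        omega)).1⟩
    · refine (hB t (p t (N t)) ?_).2 k h1 h2
      rw [hpN]
      exact (le_max_left _ (B (t + 1))).trans ((le_abs_self _).trans
        ((by omega : |max (B t) (B (t + 1))| ≤ _).trans (le_abs_self _)))
    · exact ⟨-|B t|, fun m hm => (hB t m (by
        have := le_abs_self (B t)
        have := neg_le_abs m
        omega)).2⟩
  have hNstep : ∀ t, N (t + 1) = N t := by
    intro t
    obtain ⟨s, D, h1, -⟩ := hstep t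
    exact ((hp (t + 1)).unique h1).1
  have hN : ∀ t, N t = N 0 := by
    intro t
    induction t using Int.induction_on with
    | zero => rfl
    | succ t ih => rw [hNstep, ih]
    | pred t ih =>
      have := hNstep (-(t : ℤ) - 1)
      rw [sub_add_cancel] at this
      rw [← this, ih]
  generalize N 0 = N₀ at hN
  obtain rfl : N = fun _ => N₀ := funext hN
  have hend : ∀ t n, ∃ b, n < N₀ → p t n ≤ b ∧ b < p t (n + 1) ∧
      (∀ m, p t n ≤ m → m ≤ b → w t m < M + 1) ∧
      ∀ m, b < m → m < p t (n + 1) → w t m = M + 1 := by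
    intro t n
    rcases Nat.lt_or_ge n N₀ with h1 | h1
    · obtain ⟨b, hb⟩ := (hp t).exists_block_end h1
      exact ⟨b, fun _ => hb⟩
    · exact ⟨0, fun h2 => by omega⟩
  choose b hb using hend
  refine ⟨N₀, p, b, fun t => (hp t).isBlockEnumeration (fun m => (hw t m).1)
    (IsBoxBallSystem.boxIndex_eq_ite hw t) (hb t), ?_⟩
  have hev : ∀ t, ∃ D, IsBlockEvolution M N₀ (S t)
      (fun k n => letterCount (w t) k (p t n) (p t (n + 1)))
      (fun n => letterCount (w t) (M + 1) (p t n) (p t (n + 1)))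
      (fun k n => letterCount (w (t + 1)) k (p (t + 1) n) (p (t + 1) (n + 1)))
      (fun n => letterCount (w (t + 1)) (M + 1) (p (t + 1) n) (p (t + 1) (n + 1))) D := by
    intro t
    obtain ⟨s, D, h1, h2⟩ := hstep t
    refine ⟨D, h2.congr (fun _ _ _ _ _ => rfl) (fun _ _ => rfl) (fun k n _ h4 h5 => ?_)
      fun n h3 => ?_⟩
    · exact h1.letterCount_congr (hp (t + 1)) h5 (by omega)
    · have h4 := (h1.unique (hp (t + 1))).2
      rw [h4 n (by omega), h4 (n + 1) h3]
  obtain ⟨Q, D, E, Et, F, h1, h2, h3⟩ := exists_isNonautonomousUltradiscreteHungryToda hM S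
    (fun t k n => letterCount (w t) k (p t n) (p t (n + 1)))
    (fun t n => letterCount (w t) (M + 1) (p t n) (p t (n + 1))) hev
  refine ⟨Q, D, E, Et, F, fun k t n hk hk' hn => ?_, fun t n hn => ?_, h3⟩
  · obtain ⟨h4, h5, -, h6⟩ := hb t n hn
    rw [h1 k t n hk hk' hn, ← sum_Icc_eq_letterCount h4 h5 h6 (by omega)]
    refine Finset.sum_congr rfl fun m _ => ?_
    rw [IsBoxBallSystem.box_eq_ite hw t m hk (by omega)]
    push_cast
    rfl
  · obtain ⟨h4, h5, h6, -⟩ := hb t n (by omega)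
    rw [h2 t n hn, ← sum_Ioo_eq_letterCount h4 h5 h6]
    congr 1
    refine Finset.sum_congr rfl fun m _ => ?_
    have h7 := IsBoxBallSystem.box_eq_ite hw t m (k := M + 1) (by omega) le_rfl
    rw [ZMod.natCast_self] at h7
    rw [h7]
    push_cast
    rfl
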